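/- Let $n,l\ge 1$, and let $\mathcal H=0$ be a real scalar PDE of order $l$ for a function $u(q^1,\dots,q^n)$, where $\mathcal H$ is a $C^\infty$ function, on an open set, of $q$ and of the derivatives of $u$ of order $\le l$. Let $M$ be the space with coordinates $(q^i,u,u_i^{(k)})$, $1\le i\le n$, $1\le k\le l$ (with $u_i^{(1)}=u_i$), and denote again by $\mathcal H(q^i,u,u_i,u_i^{(2)},\dots,u_i^{(l)})$ the function on $M$ obtained by putting all mixed derivatives equal to zero. Let $P\in M$ be a point in the domain of $\mathcal H$ with $\mathcal H(P)=0$ and $d\mathcal H(P)\neq0$. A family $u(q,c)=\sum_{i=1}^n S_i(q^i,c)$, with $S_i$ smooth, $q$ in an open box $I_1\times\dots\times I_n$ (each $I_i\subseteq\mathbb R$ open) and $c$ in an open subset of $\mathbb R^m$, is called * an internal solution if $m=nl$, every $u(\cdot,c)$ solves the PDE, and the matrix $\big[\partial u/\partial c_a\,|\,\partial (\partial_iu)/\partial c_a\,|\cdots|\,\partial(\partial_i^{\,l}u)/\partial c_a\big]$ has rank $nl$ for all $(q,c)$; * an extended solution if $m=nl+1$, $u(\cdot,c)$ solves the PDE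 whenever $c_{nl+1}=0$, and the determinant of the same (now square) matrix is $\ne0$ for all $(q,c)$. The equation $\mathcal H=0$ is called (additively) separable at $P$ in the coordinates $(q^i)$ if there is an extended solution such that $(q,u,\partial_iu,\dots,\partial_i^{\,l}u)=P$ for some $q$ and some $c$ with $c_{nl+1}=0$. For functions $R_1,\dots,R_n$ on an open subset of $M$ let $$D_i=\partial_i+u_i\frac{\partial}{\partial u}+u_i^{(2)}\frac{\partial}{\partial u_i}+\dots+u_i^{(l)}\frac{\partial}{\partial u_i^{(l-1)}}+R_i\frac{\partial}{\partial u_i^{(l)}} .$$ Then $\mathcal H=0$ is separable at $P$ if and only if there is an internal solution such that $(q,u,\partial_iu,\dots,\partial_i^{\,l}u)=P$ for some $(q,c)$, and if and only if either of the following equivalent conditions holds on some open neighbourhood of $P$ in $M$: 1) there are smooth functions $R_i$ and $\lambda_i$ with $D_i\mathcal H=\lambda_i\mathcal H$ for all $i$ and $D_iR_j=0$ for all $j\ne i$; 2) there are smooth functions $R_i$ and a smooth nowhere vanishing function $\Lambda$ with $D_i(\mathcal H/\Lambda)=0$ for all $i$ and $D_iR_j=0$ for all $j\neq i$. Moreover,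 $\mathcal H=0$ is separable at $P$ if the following condition holds on some open neighbourhood of $P$ in $M$; and if $\partial\mathcal H/\partial u_i^{(l)}(P)\neq0$ for all $i$, then this condition is equivalent to separability at $P$, hence to 1) and 2): 3) there are smooth functions $R_i$ with $D_i\mathcal H=0$ for all $i$ and $D_iR_j=0$ at all points where $\mathcal H=0$, for all $j\neq i$. -/

import Mathlib

open scoped ContDiff

noncomputable section

namespace NullSep

/-- The partial derivative `∂f/∂qⁱ` of a function of `q = (q¹, …, qⁿ)`. -/
def pderiv {n : ℕ} (i : Fin n) (f : (Fin n → ℝ) → ℝ) : (Fin n → ℝ) → ℝ :=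
  fun q => fderiv ℝ f q (Pi.single i 1)

/-- Multi-indices `α = (α₁, …, αₙ)` with `|α| ≤ l`. -/
abbrev MultiIndex (n l : ℕ) : Type :=
  {α : Fin n → Fin (l + 1) // ∑ i, (α i : ℕ) ≤ l}

/-- The partial derivative `∂₁^α₁ ⋯ ∂ₙ^αₙ f`. -/
def mpderiv {n l : ℕ} (α : MultiIndex n l) (f : (Fin n → ℝ) → ℝ) : (Fin n → ℝ) → ℝ :=
  (List.finRange n).foldr (fun i g => (pderiv i)^[(α.1 i : ℕ)] g) f

/-- The space of the variables `(q, (u_α)_{|α| ≤ l})` of a scalar PDE of order `l`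
in `n` independent variables. -/
abbrev FullJet (n l : ℕ) : Type := (Fin n → ℝ) × (MultiIndex n l → ℝ)

/-- The point `(q, (∂^α u(q))_{|α| ≤ l})`. -/
def fullJet {n : ℕ} (l : ℕ) (u : (Fin n → ℝ) → ℝ) (q : Fin n → ℝ) : FullJet n l :=
  (q, fun α => mpderiv α u q)

/-- The bundle `M` with coordinates `(qⁱ, u, uᵢ⁽ᵏ⁾)`, `1 ≤ i ≤ n`, `1 ≤ k ≤ l`.
For `p : M n l`: `p.1 i = qⁱ`, `p.2.1 = u`, and `p.2.2 i k = uᵢ⁽ᵏ⁺¹⁾` for `k = 0, …, l - 1`. -/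
abbrev M (n l : ℕ) : Type := (Fin n → ℝ) × ℝ × (Fin n → Fin l → ℝ)

/-- The point `(q, u(q), (∂ᵢᵏ u(q)))` of `M`. -/
def jet {n : ℕ} (l : ℕ) (u : (Fin n → ℝ) → ℝ) (q : Fin n → ℝ) : M n l :=
  (q, u q, fun i k => (pderiv i)^[(k : ℕ) + 1] u q)

/-- The inclusion of `M` in the space of all variables of the PDE: the mixed derivatives
are set equal to zero. -/
def incl {n l : ℕ} (p : M n l) : FullJet n l :=
  (p.1, fun α =>
    if ∀ j, (α.1 j : ℕ) = 0 then p.2.1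
    else ∑ i, if h : 0 < (α.1 i : ℕ) ∧ ∀ j, j ≠ i → (α.1 j : ℕ) = 0
      then p.2.2 i ⟨(α.1 i : ℕ) - 1, by have := (α.1 i).isLt; omega⟩ else 0)

/-- The reduced function `H(q, u, uᵢ, uᵢ⁽²⁾, …, uᵢ⁽ˡ⁾)` on `M` of the PDE `𝓗 = 0`. -/
def reduced {n l : ℕ} (𝓗 : FullJet n l → ℝ) : M n l → ℝ := fun p => 𝓗 (incl p)

/-- The matrix `[∂u/∂c_a | ∂uᵢ/∂c_a | ⋯ | ∂uᵢ⁽ˡ⁾/∂c_a]` at `(q, c)`; the rows are indexed by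
the parameters, the column `none` belongs to `u` and the column `some (i, k)` to `uᵢ⁽ᵏ⁺¹⁾`. -/
def paramMatrix {n : ℕ} (l : ℕ) {m : ℕ} (u : (Fin n → ℝ) → (Fin m → ℝ) → ℝ)
    (q : Fin n → ℝ) (c : Fin m → ℝ) : Matrix (Fin m) (Option (Fin n × Fin l)) ℝ :=
  Matrix.of fun a A =>
    match A with
    | none => fderiv ℝ (fun c' => (jet l (fun x => u x c') q).2.1) c (Pi.single a 1)
    | some (i, k) => fderiv ℝ (fun c' => (jet l (fun x => u x c') q).2.2 i k) c (Pi.single a 1)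

/-- `u(q, c) = ∑ᵢ Sᵢ(qⁱ, c)` for `qⁱ ∈ Iᵢ` and `c ∈ C`, with smooth `Sᵢ`. -/
def IsSeparatedFamily {n m : ℕ} (I : Fin n → Set ℝ) (C : Set (Fin m → ℝ))
    (u : (Fin n → ℝ) → (Fin m → ℝ) → ℝ) : Prop :=
  (∀ i, IsOpen (I i)) ∧ IsOpen C ∧
  ∃ S : Fin n → ℝ → (Fin m → ℝ) → ℝ,
    (∀ i, ContDiffOn ℝ ∞ (fun x : ℝ × (Fin m → ℝ) => S i x.1 x.2) (I i ×ˢ C)) ∧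
    ∀ q ∈ Set.univ.pi I, ∀ c ∈ C, u q c = ∑ i, S i (q i) c

/-- `u` is a complete internal separated solution of the PDE `𝓗 = 0` (`𝓗` with domain `U`). -/
structure IsInternalSolution {n l : ℕ} (U : Set (FullJet n l)) (𝓗 : FullJet n l → ℝ)
    (I : Fin n → Set ℝ) (C : Set (Fin (n * l) → ℝ))
    (u : (Fin n → ℝ) → (Fin (n * l) → ℝ) → ℝ) : Prop where
  separated : IsSeparatedFamily I C u
  solution : ∀ q ∈ Set.univ.pi I, ∀ c ∈ C,
    fullJet l (fun x => u x c) q ∈ U ∧ 𝓗 (fullJet l (fun x => u x c) q) = 0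
  complete : ∀ q ∈ Set.univ.pi I, ∀ c ∈ C, (paramMatrix l u q c).rank = n * l

/-- `u` is a complete extended separated solution of the PDE `𝓗 = 0` (`𝓗` with domain `U`).
The `(nl+1) × (nl+1)` matrix in `complete` has rank `nl + 1` iff its determinant is not `0`. -/
structure IsExtendedSolution {n l : ℕ} (U : Set (FullJet n l)) (𝓗 : FullJet n l → ℝ)
    (I : Fin n → Set ℝ) (C : Set (Fin (n * l + 1) → ℝ))
    (u : (Fin n → ℝ) → (Fin (n * l + 1) → ℝ) → ℝ) : Prop where
  separated : IsSeparatedFamily I C u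
  solution : ∀ q ∈ Set.univ.pi I, ∀ c ∈ C, c (Fin.last (n * l)) = 0 →
    fullJet l (fun x => u x c) q ∈ U ∧ 𝓗 (fullJet l (fun x => u x c) q) = 0
  complete : ∀ q ∈ Set.univ.pi I, ∀ c ∈ C, (paramMatrix l u q c).rank = n * l + 1

/-- There is an internal solution one of whose members passes through the point `P` of `M`. -/
def HasInternalSolutionAt {n l : ℕ} (U : Set (FullJet n l)) (𝓗 : FullJet n l → ℝ)
    (P : M n l) : Prop :=
  ∃ (I : Fin n → Set ℝ) (C : Set (Fin (n * l) → ℝ)) (u : (Fin n → ℝ) → (Fin (n * l) → ℝ) → ℝ),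
    IsInternalSolution U 𝓗 I C u ∧
    ∃ q ∈ Set.univ.pi I, ∃ c ∈ C, jet l (fun x => u x c) q = P

/-- There is an extended solution such that a member with last parameter `0` passes through
the point `P` of `M`. -/
def HasExtendedSolutionAt {n l : ℕ} (U : Set (FullJet n l)) (𝓗 : FullJet n l → ℝ)
    (P : M n l) : Prop :=
  ∃ (I : Fin n → Set ℝ) (C : Set (Fin (n * l + 1) → ℝ))
    (u : (Fin n → ℝ) → (Fin (n * l + 1) → ℝ) → ℝ),
    IsExtendedSolution U 𝓗 I C u ∧
    ∃ q ∈ Set.univ.pi I, ∃ c ∈ C, c (Fin.last (n * l)) = 0 ∧ jet l (fun x => u x c) q = P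

/-- The value at `p` of the vector field
`Dᵢ = ∂ᵢ + uᵢ ∂/∂u + uᵢ⁽²⁾ ∂/∂uᵢ + ⋯ + uᵢ⁽ˡ⁾ ∂/∂uᵢ⁽ˡ⁻¹⁾ + Rᵢ ∂/∂uᵢ⁽ˡ⁾`. -/
def genVec {n l : ℕ} [NeZero l] (R : Fin n → M n l → ℝ) (i : Fin n) (p : M n l) : M n l :=
  (Pi.single i 1, p.2.2 i 0,
    Pi.single i fun k : Fin l =>
      if h : (k : ℕ) + 1 < l then p.2.2 i ⟨(k : ℕ) + 1, h⟩ else R i p)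

/-- The function `Dᵢ F`. -/
def gen {n l : ℕ} [NeZero l] (R : Fin n → M n l → ℝ) (i : Fin n) (F : M n l → ℝ) :
    M n l → ℝ :=
  fun p => fderiv ℝ F p (genVec R i p)

/-- The partial derivative `∂F/∂uᵢ⁽ˡ⁾`. -/
def topDeriv {n l : ℕ} [NeZero l] (i : Fin n) (F : M n l → ℝ) (p : M n l) : ℝ :=
  fderiv ℝ F p (0, 0, Pi.single i (Pi.single (Fin.ofNat l (l - 1)) 1))

/-- Condition 1, on `V`: `Dᵢ H = λᵢ H`, and `Dᵢ Rⱼ = 0` for `j ≠ i`. -/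
def Cond1On {n l : ℕ} [NeZero l] (H : M n l → ℝ) (V : Set (M n l)) : Prop :=
  ∃ R lam : Fin n → M n l → ℝ,
    (∀ i, ContDiffOn ℝ ∞ (R i) V) ∧ (∀ i, ContDiffOn ℝ ∞ (lam i) V) ∧
    (∀ i, ∀ p ∈ V, gen R i H p = lam i p * H p) ∧
    ∀ i j, j ≠ i → ∀ p ∈ V, gen R i (R j) p = 0

/-- Condition 2, on `V`: `Dᵢ (H / Λ) = 0`, and `Dᵢ Rⱼ = 0` for `j ≠ i`. -/
def Cond2On {n l : ℕ} [NeZero l] (H : M n l → ℝ) (V : Set (M n l)) : Prop :=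
  ∃ (R : Fin n → M n l → ℝ) (Lam : M n l → ℝ),
    (∀ i, ContDiffOn ℝ ∞ (R i) V) ∧ ContDiffOn ℝ ∞ Lam V ∧ (∀ p ∈ V, Lam p ≠ 0) ∧
    (∀ i, ∀ p ∈ V, gen R i (fun p' => H p' / Lam p') p = 0) ∧
    ∀ i j, j ≠ i → ∀ p ∈ V, gen R i (R j) p = 0

/-- Condition 3, on `V`: `Dᵢ H = 0`, and `Dᵢ Rⱼ` vanishes on `H = 0` for `j ≠ i`. -/
def Cond3On {n l : ℕ} [NeZero l] (H : M n l → ℝ) (V : Set (M n l)) : Prop :=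
  ∃ R : Fin n → M n l → ℝ,
    (∀ i, ContDiffOn ℝ ∞ (R i) V) ∧
    (∀ i, ∀ p ∈ V, gen R i H p = 0) ∧
    ∀ i j, j ≠ i → ∀ p ∈ V, H p = 0 → gen R i (R j) p = 0

/-- `cond` holds on some open neighbourhood of `P` on which the reduced function is defined. -/
def LocallyAt {n l : ℕ} (U : Set (FullJet n l)) (P : M n l) (cond : Set (M n l) → Prop) : Prop :=
  ∃ V : Set (M n l), IsOpen V ∧ P ∈ V ∧ V ⊆ incl ⁻¹' U ∧ cond V

end NullSep

end

/-! A separated family turns the vector fields D_i into coordinate fields: along Φ(q, c) = (q, u,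
∂_i^k u) with u = ∑ S_i(q^i, c), the field ∂/∂q^i is carried to D_i with R_i = ∂_i^{l+1} S_i. For an
extended solution Φ is a local diffeomorphism. Hence D_i R_j = 0 for j ≠ i, and the last parameter
becomes a function κ on M with D_i κ = 0. Since H vanishes where κ does, Hadamard's lemma gives H =
Λκ, and dH(P) ≠ 0 forces Λ(P) ≠ 0; this is condition 2 (`HasExtendedSolutionAt.locallyAt_cond2On`).
Condition 1 follows with λ_i = D_iΛ/Λ, and condition 3 by adding a multiple of H to each R_i.

Conversely, conditions 1 and 3 both yield |D_i H| ≤ K|H| and |D_i R_j| ≤ K|H| near P, and these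
estimates suffice (`hasExtendedSolutionAt_of_abs_gen_le`). Off H = 0 the D_i need not commute, so
each D_i is integrated only along the i-th axis through the base point q₀ of P. The initial values
fill the fibre over q₀, with H as last parameter. The u-components of these curves, suitably
normalised, are the S_i. It remains to see that H vanishes on the jets off the axes when it does so
over q₀. The errors H∘Φ and S_j^{(l+1)} − R_j∘Φ solve a homogeneous Goursat problem: the partial
derivatives ∂_i(H∘Φ) and, for j ≠ i, ∂_i(R_j∘Φ) are bounded by a multiple of the errors. On a small
box every bound for the errors can be halved, so they vanish (`eq_zero_of_goursat`).

Internal and extended solutions differ by one parameter: it is set to 0, or it is introduced as the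
factor of a separated function transverse to the given family.

Smooth dependence of flows on initial values, and the smoothness of Hadamard quotients, both come
from the smoothness of superposition operators on spaces of continuous paths. -/

noncomputable section

namespace NullSep

open Set Filter Topology Metric

/-! ### Smoothness of superposition operators -/

section Nemytskii

variable {X : Type*} [TopologicalSpace X]

/-- Pointwise application of a continuous family of operators to a continuous family of vectors. -/
def pointwiseApply (X E F : Type*) [TopologicalSpace X] [CompactSpace X]
    [NormedAddCommGroup E] [NormedSpace ℝ E] [NormedAddCommGroup F] [NormedSpace ℝ F] :
    C(X, E →L[ℝ] F) →L[ℝ] C(X, E) →L[ℝ] C(X, F) :=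
  LinearMap.mkContinuous₂
    (LinearMap.mk₂ ℝ
      (fun (A : C(X, E →L[ℝ] F)) (γ : C(X, E)) => (⟨fun t => A t (γ t), by fun_prop⟩ : C(X, F)))
      (fun A B γ => by ext t; simp)
      (fun a A γ => by ext t; simp)
      (fun A γ δ => by ext t; simp)
      (fun a A γ => by ext t; simp)) 1
    (fun A γ => by
      rw [ContinuousMap.norm_le _ (by positivity)]
      intro t
      rw [one_mul]
      refine ((A t).le_opNorm (γ t)).trans ?_
      gcongr
      · exact A.norm_coe_le_norm t
      · exact γ.norm_coe_le_norm t)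

@[simp]
theorem pointwiseApply_apply {E F : Type*} [CompactSpace X]
    [NormedAddCommGroup E] [NormedSpace ℝ E] [NormedAddCommGroup F] [NormedSpace ℝ F]
    (A : C(X, E →L[ℝ] F)) (γ : C(X, E)) (t : X) :
    pointwiseApply X E F A γ t = A t (γ t) := rfl

variable {E F : Type*} [NormedAddCommGroup E] [NormedAddCommGroup F]

/-- The superposition operator `γ ↦ f ∘ γ`. -/
def postcomp (X : Type*) [TopologicalSpace X] (f : E → F) (hf : Continuous f) (γ : C(X, E)) :
    C(X, F) :=
  (⟨f, hf⟩ : C(E, F)).comp γ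

@[simp]
theorem postcomp_apply (f : E → F) (hf : Continuous f) (γ : C(X, E)) (t : X) :
    postcomp X f hf γ t = f (γ t) := rfl

variable [CompactSpace X] [NormedSpace ℝ E] [NormedSpace ℝ F]

/-- The mean value inequality on the segment from γ(t) to γ'(t) gives the estimate for each t. It is
uniform in t because γ ↦ Df∘γ is continuous in the sup norm. -/
theorem hasFDerivAt_postcomp {f : E → F} (hf : ContDiff ℝ 1 f) (γ : C(X, E)) :
    HasFDerivAt (postcomp X f hf.continuous)
      (pointwiseApply X E F (postcomp X (fderiv ℝ f) (hf.continuous_fderiv one_ne_zero) γ)) γ := by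
  have hc : Continuous (postcomp X (fderiv ℝ f) (hf.continuous_fderiv one_ne_zero)) :=
    ContinuousMap.continuous_postcomp _
  refine .of_isLittleO (Asymptotics.isLittleO_iff.2 fun ε hε => ?_)
  obtain ⟨δ, hδ, h⟩ := Metric.continuous_iff.1 hc γ ε hε
  filter_upwards [Metric.ball_mem_nhds γ hδ] with γ' hγ'
  rw [ContinuousMap.norm_le _ (by positivity)]
  intro t
  have key := (convex_segment (𝕜 := ℝ) (γ t) (γ' t)).norm_image_sub_le_of_norm_hasFDerivWithin_le'
    (f := f) (f' := fderiv ℝ f) (φ := fderiv ℝ f (γ t)) (C := ε)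
    (fun y _ => ((hf.differentiable one_ne_zero) y).hasFDerivAt.hasFDerivWithinAt) ?_
    (left_mem_segment ℝ _ _) (right_mem_segment ℝ _ _)
  · simp only [ContinuousMap.sub_apply, postcomp_apply, pointwiseApply_apply]
    refine key.trans ?_
    gcongr
    exact (γ' - γ).norm_coe_le_norm t
  · intro y hy
    obtain ⟨s, hs, rfl⟩ := (segment_eq_image' ℝ (γ t) (γ' t)) ▸ hy
    -- A point of the segment at time t is the value at t of a whole path in the δ-ball around γ, so
    -- the sup-norm estimate applies to it.
    have hlt := h (γ + s • (γ' - γ)) (by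
      rw [dist_eq_norm, add_sub_cancel_left, norm_smul, Real.norm_eq_abs, abs_of_nonneg hs.1]
      rw [mem_ball, dist_eq_norm] at hγ'
      nlinarith [hs.2, norm_nonneg (γ' - γ)])
    rw [dist_eq_norm] at hlt
    exact ((postcomp X (fderiv ℝ f) (hf.continuous_fderiv one_ne_zero) (γ + s • (γ' - γ)) -
      postcomp X (fderiv ℝ f) (hf.continuous_fderiv one_ne_zero) γ).norm_coe_le_norm t).trans
      hlt.le

end Nemytskii

section Smooth

universe u
variable {X : Type*} [TopologicalSpace X] [CompactSpace X]
variable {E F : Type u} [NormedAddCommGroup E] [NormedSpace ℝ E]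
  [NormedAddCommGroup F] [NormedSpace ℝ F]

theorem contDiff_of_bilinear {G : Type*} [NormedAddCommGroup G] [NormedSpace ℝ G]
    {n : WithTop ℕ∞} (L : C(X, G) →L[ℝ] C(X, E) →L[ℝ] C(X, F)) : ContDiff ℝ n L :=
  L.contDiff

/-- The derivative is a continuous linear map applied to the superposition operator of Df, which is
of the same kind; hence the induction. `F` is quantified because Df takes values in another space,
and `E` and `F` share a universe so that this space is admissible. -/
theorem contDiff_nat_postcomp (n : ℕ) : ∀ {F : Type u} [NormedAddCommGroup F] [NormedSpace ℝ F]
    {f : E → F} (hf : ContDiff ℝ ∞ f), ContDiff ℝ n (postcomp X f hf.continuous) := by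
  induction n with
  | zero => intro F _ _ f hf; exact contDiff_zero.2 (ContinuousMap.continuous_postcomp _)
  | succ k ih =>
    intro F _ _ f hf
    have h1 : ContDiff ℝ 1 f := hf.of_le (by exact_mod_cast le_top)
    have hf' : ContDiff ℝ ∞ (fderiv ℝ f) := hf.fderiv_right (m := ∞) le_rfl
    rw [Nat.cast_succ, contDiff_succ_iff_hasFDerivAt]
    have h2 : ContDiff ℝ k (pointwiseApply X E F) :=
      contDiff_of_bilinear (pointwiseApply X E F)
    exact ⟨fun γ => pointwiseApply X E F (postcomp X (fderiv ℝ f) hf'.continuous γ),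
      h2.comp (ih hf'), fun γ => hasFDerivAt_postcomp h1 γ⟩

theorem contDiff_postcomp {f : E → F} (hf : ContDiff ℝ ∞ f) :
    ContDiff ℝ ∞ (postcomp X f hf.continuous) :=
  contDiff_infty.2 fun n => contDiff_nat_postcomp n hf

end Smooth

/-! ### Integration of paths -/

section Primitive

open MeasureTheory intervalIntegral unitInterval

variable {E : Type*} [NormedAddCommGroup E]

theorem continuous_comp_projIcc (γ : C(I, E)) :
    Continuous fun s : ℝ => γ (projIcc 0 1 zero_le_one s) :=
  γ.continuous.comp continuous_projIcc

/-- The primitive `t ↦ ∫₀ᵗ γ` as an operator on paths. -/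
def primitive (E : Type*) [NormedAddCommGroup E] [NormedSpace ℝ E] : C(I, E) →L[ℝ] C(I, E) :=
  LinearMap.mkContinuous
    { toFun := fun γ => ⟨fun t => ∫ s in (0 : ℝ)..t, γ (projIcc 0 1 zero_le_one s),
        (continuous_primitive (fun a b => (continuous_comp_projIcc γ).intervalIntegrable a b)
          0).comp continuous_subtype_val⟩
      map_add' := fun γ δ => by
        ext t
        exact integral_add ((continuous_comp_projIcc γ).intervalIntegrable _ _)
          ((continuous_comp_projIcc δ).intervalIntegrable _ _)
      map_smul' := fun a γ => by
        ext t
        exact integral_smul a _ } 1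
    (fun γ => by
      rw [ContinuousMap.norm_le _ (by positivity)]
      intro t
      have := norm_integral_le_of_norm_le_const (a := 0) (b := (t : ℝ)) (C := ‖γ‖)
        (f := fun s : ℝ => γ (projIcc 0 1 zero_le_one s)) (fun s _ => γ.norm_coe_le_norm _)
      rw [one_mul]
      refine this.trans ?_
      rw [sub_zero, abs_of_nonneg t.2.1]
      exact mul_le_of_le_one_right (norm_nonneg _) t.2.2)

end Primitive

/-! ### Inverse function theorem and openness of injectivity -/

section Inverse

variable {E F : Type*} [NormedAddCommGroup E] [NormedSpace ℝ E] [CompleteSpace E]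
  [NormedAddCommGroup F] [NormedSpace ℝ F]

/-- Inverse function theorem with an inverse that is smooth on an open set. -/
theorem exists_openPartialHomeomorph {f : E → F} {s : Set E} (hs : IsOpen s)
    (hf : ContDiffOn ℝ ∞ f s) {a : E} (ha : a ∈ s) {f' : E ≃L[ℝ] F}
    (hf' : HasFDerivAt f (f' : E →L[ℝ] F) a) :
    ∃ e : OpenPartialHomeomorph E F, a ∈ e.source ∧ e.source ⊆ s ∧ (∀ x, e x = f x) ∧
      ContDiffOn ℝ ∞ e.symm e.target := by
  have hfa : ContDiffAt ℝ ∞ f a := hf.contDiffAt (hs.mem_nhds ha)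
  let e₀ := hfa.toOpenPartialHomeomorph f hf' (by simp)
  have hdf : ContinuousOn (fderiv ℝ f) s := hf.continuousOn_fderiv_of_isOpen hs (by simp)
  -- On this open set the derivative stays invertible, so that the inverse is smooth at every point
  -- of the restricted target and not only at the image of `a`.
  have hopen := hdf.isOpen_inter_preimage hs (ContinuousLinearEquiv.isOpen (𝕜 := ℝ) (E := E) (F := F))
  refine ⟨e₀.restrOpen _ hopen, ⟨hfa.mem_toOpenPartialHomeomorph_source hf' (by simp), ha, ?_⟩,
    fun x hx => hx.2.1, fun x => rfl, ?_⟩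
  · rw [mem_preimage, hf'.fderiv]; exact mem_range_self _
  · intro p hp
    have hx := (e₀.restrOpen _ hopen).map_target hp
    obtain ⟨f'', hf''⟩ := hx.2.2
    refine ((e₀.restrOpen _ hopen).contDiffAt_symm (f₀' := f'') hp ?_ ?_).contDiffWithinAt
    · rw [hf'']
      exact ((hf.contDiffAt (hs.mem_nhds hx.2.1)).differentiableAt (by simp)).hasFDerivAt
    · exact hf.contDiffAt (hs.mem_nhds hx.2.1)

/-- If B is a left inverse of A, then BA' is invertible for A' near A, and A' is injective. -/
theorem isOpen_setOf_injective [FiniteDimensional ℝ E] [FiniteDimensional ℝ F] :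
    IsOpen {A : E →L[ℝ] F | Function.Injective A} := by
  rw [isOpen_iff_mem_nhds]
  intro A hA
  obtain ⟨B, hB⟩ := (A : E →ₗ[ℝ] F).exists_leftInverse_of_injective (LinearMap.ker_eq_bot.2 hA)
  let B' : F →L[ℝ] E := LinearMap.toContinuousLinearMap B
  have hc : Continuous fun A' : E →L[ℝ] F => B'.comp A' := by fun_prop
  have hmem : B'.comp A ∈ range ((↑) : (E ≃L[ℝ] E) → E →L[ℝ] E) :=
    ⟨ContinuousLinearEquiv.refl ℝ E, by ext x; exact (LinearMap.congr_fun hB x).symm⟩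
  filter_upwards [hc.continuousAt.preimage_mem_nhds
    ((ContinuousLinearEquiv.isOpen (𝕜 := ℝ)).mem_nhds hmem)] with A' hA'
  obtain ⟨g, hg⟩ := hA'
  have : Function.Injective (B'.comp A') := by
    rw [show B'.comp A' = (g : E →L[ℝ] E) from hg.symm]; exact g.injective
  exact Function.Injective.of_comp this

end Inverse

section Extension

variable {E F : Type*} [NormedAddCommGroup E] [NormedSpace ℝ E] [FiniteDimensional ℝ E]
  [NormedAddCommGroup F] [NormedSpace ℝ F]

/-- Multiplication by a bump function. Superposition operators need globally smooth functions; only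
the germ at `a` matters afterwards. -/
theorem exists_contDiff_eventuallyEq {f : E → F} {s : Set E} (hs : IsOpen s)
    (hf : ContDiffOn ℝ ∞ f s) {a : E} (ha : a ∈ s) :
    ∃ g : E → F, ContDiff ℝ ∞ g ∧ g =ᶠ[𝓝 a] f := by
  obtain ⟨b, hb⟩ : ∃ b : ContDiffBump a, closedBall a b.rOut ⊆ s := by
    obtain ⟨r, hr, h⟩ := nhds_basis_closedBall.mem_iff.1 (hs.mem_nhds ha)
    exact ⟨⟨r / 2, r, by positivity, by linarith⟩, h⟩
  refine ⟨fun x => b x • f x, contDiff_iff_contDiffAt.2 fun x => ?_, ?_⟩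
  · by_cases hx : x ∈ s
    · exact b.contDiffAt.smul (hf.contDiffAt (hs.mem_nhds hx))
    · have : x ∈ (tsupport b)ᶜ := fun h => hx (hb (b.tsupport_eq ▸ h))
      refine contDiffAt_const (c := (0 : F)) |>.congr_of_eventuallyEq ?_
      filter_upwards [(isClosed_tsupport b).isOpen_compl.mem_nhds this] with y hy
      simp [image_eq_zero_of_notMem_tsupport hy]
  · filter_upwards [b.eventuallyEq_one] with x hx
    simp [hx]

end Extension

/-! ### Smooth local flows from the inverse function theorem -/

section Flow

open unitInterval

universe u
variable {E : Type u} [NormedAddCommGroup E] [NormedSpace ℝ E]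

theorem contDiff_evalPath (t : I) : ContDiff ℝ ∞ fun γ : C(I, E) => γ t :=
  (ContinuousMap.evalCLM ℝ t : C(I, E) →L[ℝ] E).contDiff

/-- The constant paths. -/
def constPath (E : Type*) [NormedAddCommGroup E] [NormedSpace ℝ E] : E →L[ℝ] C(I, E) where
  toFun := ContinuousMap.const I
  map_add' _ _ := rfl
  map_smul' _ _ := rfl
  cont := ContinuousMap.continuous_const'

@[simp]
theorem constPath_apply (x : E) (t : I) : constPath E x t = x := rfl

/-- The zero set of the last component consists of the `(ε, x, γ)` with `γ' = ε f(γ)`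
and `γ(0) = x`. -/
def flowMap (f : E → E) (hf : Continuous f) (z : ℝ × E × C(I, E)) : ℝ × E × C(I, E) :=
  (z.1, z.2.1, z.2.2 - constPath E z.2.1 - z.1 • primitive E (postcomp I f hf z.2.2))

theorem contDiff_flowMap {f : E → E} (hf : ContDiff ℝ ∞ f) :
    ContDiff ℝ ∞ (flowMap f hf.continuous) := by
  have h1 := contDiff_postcomp (X := I) hf
  unfold flowMap
  fun_prop

/-- The derivative of `flowMap` at `ε = 0`. -/
def flowMapDeriv (w : C(I, E)) : (ℝ × E × C(I, E)) ≃L[ℝ] ℝ × E × C(I, E) :=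
  ContinuousLinearEquiv.equivOfInverse
    ((ContinuousLinearMap.fst ℝ ℝ (E × C(I, E))).prod
      (((ContinuousLinearMap.fst ℝ E C(I, E)).comp (ContinuousLinearMap.snd ℝ ℝ (E × C(I, E)))).prod
        ((ContinuousLinearMap.snd ℝ E C(I, E)).comp (ContinuousLinearMap.snd ℝ ℝ (E × C(I, E)))
          - (constPath E).comp ((ContinuousLinearMap.fst ℝ E C(I, E)).comp
              (ContinuousLinearMap.snd ℝ ℝ (E × C(I, E))))
          - (ContinuousLinearMap.fst ℝ ℝ (E × C(I, E))).smulRight w)))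
    ((ContinuousLinearMap.fst ℝ ℝ (E × C(I, E))).prod
      (((ContinuousLinearMap.fst ℝ E C(I, E)).comp (ContinuousLinearMap.snd ℝ ℝ (E × C(I, E)))).prod
        ((ContinuousLinearMap.snd ℝ E C(I, E)).comp (ContinuousLinearMap.snd ℝ ℝ (E × C(I, E)))
          + (constPath E).comp ((ContinuousLinearMap.fst ℝ E C(I, E)).comp
              (ContinuousLinearMap.snd ℝ ℝ (E × C(I, E))))
          + (ContinuousLinearMap.fst ℝ ℝ (E × C(I, E))).smulRight w)))
    (fun z => by ext <;> simp; abel) (fun z => by ext <;> simp; abel)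

/-- At ε = 0 the integral term contributes only through dε, so the derivative is triangular and
invertible without any estimate on f. -/
theorem hasFDerivAt_flowMap {f : E → E} (hf : ContDiff ℝ ∞ f) (x : E) (γ : C(I, E)) :
    HasFDerivAt (flowMap f hf.continuous)
      (flowMapDeriv (primitive E (postcomp I f hf.continuous γ)) :
        (ℝ × E × C(I, E)) →L[ℝ] ℝ × E × C(I, E)) (0, x, γ) := by
  have h1 : HasFDerivAt (fun z : ℝ × E × C(I, E) => primitive E (postcomp I f hf.continuous z.2.2))
      _ (0, x, γ) :=
    (((primitive E).contDiff.comp ((contDiff_postcomp (X := I) hf))).comp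
      (contDiff_snd.comp contDiff_snd)).differentiable (by simp) _ |>.hasFDerivAt
  have h2 := (hasFDerivAt_fst (𝕜 := ℝ) (p := ((0 : ℝ), x, γ))).smul h1
  have h3 : HasFDerivAt (fun z : ℝ × E × C(I, E) => z.2.1) _ (0, x, γ) :=
    (hasFDerivAt_snd (𝕜 := ℝ) (p := ((0 : ℝ), x, γ))).fst
  have h4 : HasFDerivAt (fun z : ℝ × E × C(I, E) => z.2.2) _ (0, x, γ) :=
    (hasFDerivAt_snd (𝕜 := ℝ) (p := ((0 : ℝ), x, γ))).snd
  have h5 := hasFDerivAt_fst (𝕜 := ℝ) (p := ((0 : ℝ), x, γ)) |>.prodMk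
    (h3.prodMk ((h4.sub ((constPath E).hasFDerivAt.comp _ h3)).sub h2))
  refine h5.congr_fderiv ?_
  ext z <;> simp [flowMapDeriv]

theorem flowMap_eq_iff {f : E → E} (hf : Continuous f) (ε : ℝ) (x : E) (γ : C(I, E)) :
    flowMap f hf (ε, x, γ) = (ε, x, 0) ↔
      ∀ t : I, γ t = x + ε • ∫ s in (0 : ℝ)..t, f (γ (projIcc 0 1 zero_le_one s)) := by
  simp only [flowMap, Prod.mk.injEq, true_and]
  rw [sub_sub, sub_eq_zero, ContinuousMap.ext_iff]
  rfl

/-- The path `s ↦ γ(a s)`. -/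
def rescale (a : I) (γ : C(I, E)) : C(I, E) :=
  γ.comp ⟨fun t => a * t, by fun_prop⟩

/-- If γ' = εf(γ), then s ↦ γ(as) solves the equation with speed aε, by substitution in the
integral. -/
theorem flowMap_rescale {f : E → E} (hf : Continuous f) {ε : ℝ} {x : E} {γ : C(I, E)}
    (h : flowMap f hf (ε, x, γ) = (ε, x, 0)) (a : I) :
    flowMap f hf (a * ε, x, rescale a γ) = (a * ε, x, 0) := by
  rw [flowMap_eq_iff] at h ⊢
  intro t
  have h1 : ∫ s in (0 : ℝ)..t, f (rescale a γ (projIcc 0 1 zero_le_one s)) =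
      ∫ s in (0 : ℝ)..t, f (γ (projIcc 0 1 zero_le_one (a * s))) := by
    refine intervalIntegral.integral_congr fun s hs => ?_
    rw [uIcc_of_le t.2.1] at hs
    have hs' : s ∈ Icc (0 : ℝ) 1 := ⟨hs.1, hs.2.trans t.2.2⟩
    have has : (a : ℝ) * s ∈ Icc (0 : ℝ) 1 := (a * ⟨s, hs'⟩ : I).2
    simp only [projIcc_of_mem zero_le_one hs', projIcc_of_mem zero_le_one has]
    rfl
  have h2 := intervalIntegral.smul_integral_comp_mul_left (a := 0) (b := t)
    (fun s => f (γ (projIcc 0 1 zero_le_one s))) (a : ℝ)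
  rw [mul_zero] at h2
  rw [h1, mul_comm (a : ℝ) ε, mul_smul, h2]
  exact h (a * t)

theorem rescale_mem_ball {x₀ : E} {r : ℝ} {γ : C(I, E)} (h : γ ∈ ball (constPath E x₀) r) (a : I) :
    rescale a γ ∈ ball (constPath E x₀) r := by
  rw [mem_ball, ContinuousMap.dist_lt_iff_of_nonempty] at h ⊢
  exact fun t => h (a * t)

variable [CompleteSpace E]

/-- A smooth vector field has, locally, a smooth flow. -/
theorem exists_flow_of_contDiff {f : E → E} (hf : ContDiff ℝ ∞ f) (x₀ : E) :
    ∃ r > 0, ∃ φ : ℝ × E → E, ContDiffOn ℝ ∞ φ (ball 0 r ×ˢ ball x₀ r) ∧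
      ∀ x ∈ ball x₀ r, φ (0, x) = x ∧
        ∀ t ∈ ball (0 : ℝ) r, HasDerivAt (fun s => φ (s, x)) (f (φ (t, x))) t := by
  -- Small speed on [0, 1] replaces short time: the endpoint of the path with γ' = tf(γ) is the flow
  -- at time t.
  obtain ⟨e, hz, -, he, hsmooth⟩ := exists_openPartialHomeomorph isOpen_univ
    (contDiff_flowMap hf).contDiffOn (mem_univ (0, x₀, constPath E x₀))
    (hasFDerivAt_flowMap hf x₀ (constPath E x₀))
  have hz0 : flowMap f hf.continuous (0, x₀, constPath E x₀) = (0, x₀, 0) := by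
    rw [flowMap_eq_iff]; simp
  obtain ⟨r₀, hr₀, hball⟩ := Metric.isOpen_iff.1 e.open_source _ hz
  have hT : IsOpen (e.target ∩ e.symm ⁻¹' ball (0, x₀, constPath E x₀) r₀) :=
    e.symm.isOpen_inter_preimage isOpen_ball
  obtain ⟨r, hr, hrT⟩ := Metric.isOpen_iff.1 hT (0, x₀, 0)
    ⟨by rw [← hz0, ← he]; exact e.map_source hz, by
      rw [mem_preimage, ← hz0, ← he, e.left_inv hz]; exact mem_ball_self hr₀⟩
  have hmem : ∀ p ∈ ball (0 : ℝ) r ×ˢ ball x₀ r, ((p.1, p.2, 0) : ℝ × E × C(I, E)) ∈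
      e.target ∩ e.symm ⁻¹' ball (0, x₀, constPath E x₀) r₀ := fun p hp => hrT (by
    rw [← ball_prod_same, ← ball_prod_same]
    exact ⟨hp.1, hp.2, mem_ball_self hr⟩)
  let Γ : ℝ × E → C(I, E) := fun p => (e.symm (p.1, p.2, 0)).2.2
  have hΓ : ∀ p ∈ ball (0 : ℝ) r ×ˢ ball x₀ r, e.symm (p.1, p.2, 0) = (p.1, p.2, Γ p) ∧
      flowMap f hf.continuous (p.1, p.2, Γ p) = (p.1, p.2, 0) := by
    intro p hp
    have h1 := e.right_inv (hmem p hp).1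
    rw [he] at h1
    have h2 : e.symm (p.1, p.2, 0) = (p.1, p.2, Γ p) := by
      have h3 : (e.symm (p.1, p.2, 0)).1 = p.1 := congrArg Prod.fst h1
      have h4 : (e.symm (p.1, p.2, 0)).2.1 = p.2 := congrArg (fun z => z.2.1) h1
      exact Prod.ext h3 (Prod.ext h4 rfl)
    exact ⟨h2, h2 ▸ h1⟩
  -- The rescaled path and Γ(aε, x) have the same image under `e` and both lie in its source, hence
  -- agree. Thus intermediate values of a path are endpoints of slower paths, which turns the
  -- equation for paths into an integral equation for φ.
  have hscale : ∀ p ∈ ball (0 : ℝ) r ×ˢ ball x₀ r, ∀ a : I, Γ p a = Γ (a * p.1, p.2) 1 := by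
    intro p hp a
    have hap : ((a : ℝ) * p.1, p.2) ∈ ball (0 : ℝ) r ×ˢ ball x₀ r := by
      refine ⟨?_, hp.2⟩
      have := hp.1
      rw [mem_ball_zero_iff] at this ⊢
      rw [norm_mul, Real.norm_of_nonneg a.2.1]
      exact (mul_le_of_le_one_left (norm_nonneg _) a.2.2).trans_lt this
    have hb := (hmem p hp).2
    rw [mem_preimage, (hΓ p hp).1, ← ball_prod_same, ← ball_prod_same] at hb
    have hs : ((a * p.1, p.2, rescale a (Γ p)) : ℝ × E × C(I, E)) ∈ e.source := hball (by
      rw [← ball_prod_same, ← ball_prod_same]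
      refine ⟨?_, hb.2.1, rescale_mem_ball hb.2.2 a⟩
      have := hb.1
      rw [mem_ball_zero_iff] at this ⊢
      rw [norm_mul, Real.norm_of_nonneg a.2.1]
      exact (mul_le_of_le_one_left (norm_nonneg _) a.2.2).trans_lt this)
    have h1 := e.left_inv hs
    rw [he, flowMap_rescale hf.continuous (hΓ p hp).2 a] at h1
    have h2 : Γ (a * p.1, p.2) = rescale a (Γ p) := congrArg (fun z => z.2.2) h1
    rw [h2]
    simp [rescale]
  let φ : ℝ × E → E := fun p => Γ p 1
  have hφs : ContDiffOn ℝ ∞ φ (ball 0 r ×ˢ ball x₀ r) := by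
    have h1 : ContDiffOn ℝ ∞ (fun p : ℝ × E => e.symm (p.1, p.2, 0)) (ball 0 r ×ˢ ball x₀ r) :=
      hsmooth.comp (by fun_prop) fun p hp => (hmem p hp).1
    exact (contDiff_evalPath 1).comp_contDiffOn h1.snd.snd
  have hint : ∀ x ∈ ball x₀ r, ∀ t ∈ ball (0 : ℝ) r,
      φ (t, x) = x + ∫ s in (0 : ℝ)..t, f (φ (s, x)) := by
    intro x hx t ht
    have h1 := (flowMap_eq_iff hf.continuous t x _).1 (hΓ (t, x) ⟨ht, hx⟩).2 1
    have h2 := intervalIntegral.smul_integral_comp_mul_right (a := 0) (b := 1)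
      (fun s => f (φ (s, x))) t
    rw [zero_mul, one_mul] at h2
    rw [← h2]
    refine h1.trans ?_
    congr 2
    refine intervalIntegral.integral_congr fun s hs => ?_
    have hs' : s ∈ Icc (0 : ℝ) 1 := by simpa using hs
    simp only [projIcc_of_mem zero_le_one hs']
    rw [hscale (t, x) ⟨ht, hx⟩]
  refine ⟨r, hr, φ, hφs, fun x hx => ⟨by simpa using hint x hx 0 (mem_ball_self hr), ?_⟩⟩
  intro t ht
  have hc : ContinuousOn (fun s => f (φ (s, x))) (ball 0 r) :=
    hf.continuous.comp_continuousOn (hφs.continuousOn.comp (by fun_prop) fun s hs => ⟨hs, hx⟩)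
  have hsub : uIcc 0 t ⊆ ball (0 : ℝ) r :=
    (convex_ball (0 : ℝ) r).ordConnected.uIcc_subset (mem_ball_self hr) ht
  have h1 := (intervalIntegral.integral_hasDerivAt_right
    ((hc.mono hsub).intervalIntegrable) (hc.stronglyMeasurableAtFilter isOpen_ball t ht)
    (hc.continuousAt (isOpen_ball.mem_nhds ht))).const_add x
  refine h1.congr_of_eventuallyEq ?_
  filter_upwards [isOpen_ball.mem_nhds ht] with s hs using hint x hx s hs

/-- A vector field which is smooth on an open set has, locally, a smooth flow. -/
theorem exists_flow {E : Type u} [NormedAddCommGroup E] [NormedSpace ℝ E] [FiniteDimensional ℝ E]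
    {f : E → E} {V : Set E} (hV : IsOpen V) (hf : ContDiffOn ℝ ∞ f V) {x₀ : E} (hx₀ : x₀ ∈ V) :
    ∃ r > 0, ∃ φ : ℝ × E → E, ContDiffOn ℝ ∞ φ (ball 0 r ×ˢ ball x₀ r) ∧
      ∀ x ∈ ball x₀ r, φ (0, x) = x ∧ ∀ t ∈ ball (0 : ℝ) r, φ (t, x) ∈ V ∧
        HasDerivAt (fun s => φ (s, x)) (f (φ (t, x))) t := by
  have : CompleteSpace E := FiniteDimensional.complete ℝ E
  obtain ⟨g, hg, hgf⟩ := exists_contDiff_eventuallyEq hV hf hx₀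
  obtain ⟨r, hr, φ, hφ, h⟩ := exists_flow_of_contDiff hg x₀
  have h0 : φ (0, x₀) = x₀ := (h x₀ (mem_ball_self hr)).1
  have hcont : ContinuousAt φ (0, x₀) := hφ.continuousOn.continuousAt
    ((isOpen_ball.prod isOpen_ball).mem_nhds ⟨mem_ball_self hr, mem_ball_self hr⟩)
  have hev : ∀ᶠ p in 𝓝 ((0 : ℝ), x₀), g (φ p) = f (φ p) ∧ φ p ∈ V := by
    rw [ContinuousAt, h0] at hcont
    exact hcont.eventually (hgf.and (hV.mem_nhds hx₀))
  obtain ⟨ρ, hρ, hb⟩ := Metric.eventually_nhds_iff_ball.1 hev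
  rw [← ball_prod_same] at hb
  refine ⟨min r ρ, lt_min hr hρ, φ, hφ.mono (prod_mono (ball_subset_ball (min_le_left _ _))
    (ball_subset_ball (min_le_left _ _))), fun x hx => ?_⟩
  have hx' := ball_subset_ball (min_le_left r ρ) hx
  refine ⟨(h x hx').1, fun t ht => ?_⟩
  obtain ⟨h1, h2⟩ := hb (t, x) ⟨ball_subset_ball (min_le_right r ρ) ht,
    ball_subset_ball (min_le_right r ρ) hx⟩
  refine ⟨h2, ?_⟩
  rw [← h1]
  exact (h x hx').2 t (ball_subset_ball (min_le_left r ρ) ht)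

end Flow

/-! ### Division by a function with nonzero differential -/

section Division

open unitInterval

universe u
variable {E : Type u} [NormedAddCommGroup E] [NormedSpace ℝ E]

/-- Around a regular zero `P` of `H` there is a chart in which `H` is the linear function
`dH(P)`. -/
theorem exists_straightening [CompleteSpace E] {H : E → ℝ} {V : Set E} (hV : IsOpen V)
    (hH : ContDiffOn ℝ ∞ H V) {P : E} (hP : P ∈ V) (h0 : H P = 0) (hreg : fderiv ℝ H P ≠ 0) :
    ∃ e : OpenPartialHomeomorph E E, P ∈ e.source ∧ e.source ⊆ V ∧ e P = 0 ∧
      ContDiffOn ℝ ∞ e e.source ∧ ContDiffOn ℝ ∞ e.symm e.target ∧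
      ∀ p ∈ e.source, fderiv ℝ H P (e p) = H p := by
  obtain ⟨v, hv⟩ : ∃ v, fderiv ℝ H P v = 1 := by
    obtain ⟨w, hw⟩ := DFunLike.ne_iff.1 hreg
    refine ⟨(fderiv ℝ H P w)⁻¹ • w, ?_⟩
    rw [map_smul, smul_eq_mul, inv_mul_cancel₀ hw]
  set ℓ := fderiv ℝ H P
  -- The correction along v has derivative 0 at P, so the chart has derivative the identity there;
  -- as ℓ(v) = 1, applying ℓ to it gives H(p).
  have hχ : ContDiffOn ℝ ∞ (fun p => p - P + (H p - ℓ (p - P)) • v) V := by fun_prop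
  have hd : HasFDerivAt (fun p => p - P + (H p - ℓ (p - P)) • v)
      ((ContinuousLinearEquiv.refl ℝ E : E ≃L[ℝ] E) : E →L[ℝ] E) P := by
    have h1 : HasFDerivAt H ℓ P :=
      ((hH.contDiffAt (hV.mem_nhds hP)).differentiableAt (by simp)).hasFDerivAt
    have h2 : HasFDerivAt (fun p => p - P) (ContinuousLinearMap.id ℝ E) P :=
      (hasFDerivAt_id P).sub_const P
    refine (h2.add ((h1.sub (ℓ.hasFDerivAt.comp P h2)).smul_const v)).congr_fderiv ?_
    ext x
    simp
  obtain ⟨e, heP, heV, he, hes⟩ := exists_openPartialHomeomorph hV hχ hP hd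
  refine ⟨e, heP, heV, by simp [he, h0], (hχ.mono heV).congr fun p _ => he p, hes,
    fun p _ => ?_⟩
  rw [he]
  simp [hv]

/-- **Hadamard's lemma** for a function vanishing on a hyperplane. -/
theorem exists_hadamard_quotient {f : E → ℝ} (hf : ContDiff ℝ ∞ f) (ℓ : E →L[ℝ] ℝ) {v : E} :
    ∃ G : E → ℝ, ContDiff ℝ ∞ G ∧ ∀ x, f x - f (x - ℓ x • v) = ℓ x * G x := by
  -- The segment from x to its projection on ker ℓ. The quotient is the integral of Df along it,
  -- applied to v; its smoothness in x is that of a superposition operator, with no differentiation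
  -- under the integral.
  let path : E → C(I, E) := fun x => constPath E x - ℓ x • ⟨fun s => (s : ℝ) • v, by fun_prop⟩
  have hpath : ContDiff ℝ ∞ path := by fun_prop
  have hdf : ContDiff ℝ ∞ (fderiv ℝ f) := hf.fderiv_right (m := ∞) le_rfl
  refine ⟨fun x => primitive (E →L[ℝ] ℝ) (postcomp I (fderiv ℝ f) hdf.continuous (path x)) 1 v,
    ?_, fun x => ?_⟩
  · have h1 : ContDiff ℝ ∞ (primitive (E →L[ℝ] ℝ)) := (primitive (E →L[ℝ] ℝ)).contDiff
    exact ((contDiff_evalPath 1).comp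
      (h1.comp ((contDiff_postcomp hdf).comp hpath))).clm_apply contDiff_const
  · have hline : ∀ s : ℝ, HasDerivAt (fun s : ℝ => x - ℓ x • (s • v)) (-(ℓ x • v)) s := fun s => by
      simpa using (((hasDerivAt_id s).smul_const v).const_smul (ℓ x)).const_sub x
    have hder : ∀ s : ℝ, HasDerivAt (fun s : ℝ => f (x - ℓ x • (s • v)))
        (fderiv ℝ f (x - ℓ x • (s • v)) (-(ℓ x • v))) s := fun s =>
      ((hf.differentiable (by simp) _).hasFDerivAt).comp_hasDerivAt s (hline s)
    have hcont : Continuous fun s : ℝ => fderiv ℝ f (x - ℓ x • (s • v)) :=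
      hdf.continuous.comp (by fun_prop)
    have hftc := intervalIntegral.integral_eq_sub_of_hasDerivAt (a := 0) (b := 1)
      (fun s _ => hder s) ((hcont.clm_apply continuous_const).intervalIntegrable _ _)
    have hprim : primitive (E →L[ℝ] ℝ) (postcomp I (fderiv ℝ f) hdf.continuous (path x)) 1 =
        ∫ s in (0 : ℝ)..1, fderiv ℝ f (x - ℓ x • (s • v)) := by
      refine intervalIntegral.integral_congr fun s hs => ?_
      have hs' : s ∈ Icc (0 : ℝ) 1 := by simpa using hs
      simp [path, projIcc_of_mem zero_le_one hs']
    have happ : (∫ s in (0 : ℝ)..1, fderiv ℝ f (x - ℓ x • (s • v))) v =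
        ∫ s in (0 : ℝ)..1, fderiv ℝ f (x - ℓ x • (s • v)) v :=
      ContinuousLinearMap.intervalIntegral_apply (hcont.intervalIntegrable _ _) v
    simp only [map_neg, map_smul, smul_eq_mul, intervalIntegral.integral_neg,
      intervalIntegral.integral_const_mul] at hftc
    beta_reduce
    rw [hprim, happ]
    simp only [one_smul, zero_smul, smul_zero, sub_zero] at hftc
    linarith

/-- A smooth function vanishing on the regular hypersurface `H = 0` is a smooth multiple of `H`. -/
theorem exists_smooth_quotient [FiniteDimensional ℝ E] {H F : E → ℝ} {V : Set E} (hV : IsOpen V)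
    (hH : ContDiffOn ℝ ∞ H V) (hF : ContDiffOn ℝ ∞ F V) {P : E} (hP : P ∈ V) (h0 : H P = 0)
    (hreg : fderiv ℝ H P ≠ 0) (hz : ∀ p ∈ V, H p = 0 → F p = 0) :
    ∃ (W : Set E) (lam : E → ℝ), IsOpen W ∧ P ∈ W ∧ W ⊆ V ∧ ContDiffOn ℝ ∞ lam W ∧
      ∀ p ∈ W, F p = lam p * H p := by
  have : CompleteSpace E := FiniteDimensional.complete ℝ E
  obtain ⟨v, hv⟩ : ∃ v, fderiv ℝ H P v = 1 := by
    obtain ⟨w, hw⟩ := DFunLike.ne_iff.1 hreg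
    refine ⟨(fderiv ℝ H P w)⁻¹ • w, ?_⟩
    rw [map_smul, smul_eq_mul, inv_mul_cancel₀ hw]
  obtain ⟨e, heP, heV, he0, he, hes, heH⟩ := exists_straightening hV hH hP h0 hreg
  set ℓ := fderiv ℝ H P
  have hmaps : ∀ x ∈ e.target, e.symm x ∈ V := fun x hx => heV (e.map_target hx)
  have h0t : (0 : E) ∈ e.target := he0 ▸ e.map_source heP
  obtain ⟨f, hf, hfe⟩ := exists_contDiff_eventuallyEq e.open_target (hF.comp hes hmaps) h0t
  obtain ⟨G, hG, hGf⟩ := exists_hadamard_quotient hf ℓ (v := v)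
  have hproj : Tendsto (fun x : E => x - ℓ x • v) (𝓝 0) (𝓝 0) := by
    have : Continuous fun x : E => x - ℓ x • v := by fun_prop
    simpa using this.tendsto 0
  have hev : ∀ᶠ x in 𝓝 (0 : E), F (e.symm x) = ℓ x * G x := by
    have hfe' : ∀ᶠ x in 𝓝 (0 : E), f x = F (e.symm x) ∧ x ∈ e.target :=
      hfe.and (e.open_target.mem_nhds h0t)
    filter_upwards [hfe', hproj.eventually hfe'] with x hx hx'
    -- Since ℓ(v) = 1, the projected point lies on ℓ = 0, which is H = 0 in the chart.
    have h1 : F (e.symm (x - ℓ x • v)) = 0 := by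
      refine hz _ (hmaps _ hx'.2) ?_
      rw [← heH _ (e.map_target hx'.2), e.right_inv hx'.2]
      simp [hv]
    rw [← hx.1, ← hGf, hx'.1, h1, sub_zero]
  obtain ⟨O, hO, hOo, h0O⟩ := _root_.eventually_nhds_iff.1 hev
  refine ⟨e.source ∩ e ⁻¹' O, fun p => G (e p), e.isOpen_inter_preimage hOo,
    ⟨heP, by rwa [mem_preimage, he0]⟩, fun p hp => heV hp.1,
    hG.comp_contDiffOn (he.mono inter_subset_left), fun p hp => ?_⟩
  have := hO (e p) hp.2
  rw [e.left_inv hp.1, heH p hp.1] at this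
  rw [this, mul_comm]

end Division

/-! ### Derivatives in one real variable with parameters -/

section TimeDerivative

variable {E : Type*} [NormedAddCommGroup E] [NormedSpace ℝ E]

/-- The partial derivative with respect to the real variable. -/
def tderiv (f : ℝ × E → ℝ) : ℝ × E → ℝ := fun x => fderiv ℝ f x (1, 0)

theorem contDiffOn_tderiv_iterate {f : ℝ × E → ℝ} {W : Set (ℝ × E)} (hW : IsOpen W)
    (hf : ContDiffOn ℝ ∞ f W) (k : ℕ) : ContDiffOn ℝ ∞ (tderiv^[k] f) W := by
  induction k with
  | zero => exact hf
  | succ k ih =>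
    rw [Function.iterate_succ_apply']
    exact (ih.fderiv_of_isOpen hW (m := ∞) le_rfl).clm_apply contDiffOn_const

theorem hasDerivAt_tderiv {f : ℝ × E → ℝ} {t : ℝ} {c : E} (hf : DifferentiableAt ℝ f (t, c)) :
    HasDerivAt (fun s => f (s, c)) (tderiv f (t, c)) t :=
  hf.hasFDerivAt.comp_hasDerivAt t ((hasDerivAt_id t).prodMk (hasDerivAt_const t c))

theorem deriv_iterate_eq_tderiv {f : ℝ × E → ℝ} {W : Set (ℝ × E)} (hW : IsOpen W)
    (hf : ContDiffOn ℝ ∞ f W) (k : ℕ) {t : ℝ} {c : E} (h : (t, c) ∈ W) :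
    deriv^[k] (fun s => f (s, c)) t = tderiv^[k] f (t, c) := by
  induction k generalizing t with
  | zero => rfl
  | succ k ih =>
    rw [Function.iterate_succ_apply', Function.iterate_succ_apply']
    have hev : deriv^[k] (fun s => f (s, c)) =ᶠ[𝓝 t] fun s => tderiv^[k] f (s, c) := by
      have hc : ContinuousAt (fun s : ℝ => (s, c)) t := by fun_prop
      filter_upwards [hc.preimage_mem_nhds (hW.mem_nhds h)] with s hs using ih hs
    rw [hev.deriv_eq]
    exact (hasDerivAt_tderiv (((contDiffOn_tderiv_iterate hW hf k).contDiffAt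
      (hW.mem_nhds h)).differentiableAt (by simp))).deriv

end TimeDerivative

/-! ### Jets of separated functions -/

section SeparatedFunctions

variable {n : ℕ}

/-- `v(q) = ∑ᵢ Tᵢ(qⁱ)` on the box `I₁ × ⋯ × Iₙ`, with smooth `Tᵢ`. -/
structure SeparatedOn (I : Fin n → Set ℝ) (v : (Fin n → ℝ) → ℝ) (T : Fin n → ℝ → ℝ) : Prop where
  smooth : ∀ i, ContDiffOn ℝ ∞ (T i) (I i)
  eq_sum : ∀ q ∈ univ.pi I, v q = ∑ i, T i (q i)

variable {I : Fin n → Set ℝ} {v : (Fin n → ℝ) → ℝ} {T : Fin n → ℝ → ℝ}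

theorem isOpen_box (hI : ∀ i, IsOpen (I i)) : IsOpen (univ.pi I) :=
  isOpen_set_pi finite_univ fun i _ => hI i

theorem SeparatedOn.pderiv (hI : ∀ i, IsOpen (I i)) (h : SeparatedOn I v T) (i : Fin n) :
    SeparatedOn I (pderiv i v) (Pi.single i (deriv (T i))) where
  smooth j := by
    rcases eq_or_ne j i with rfl | hj
    · rw [Pi.single_eq_same]
      exact (h.smooth j).deriv_of_isOpen (hI j) (m := ∞) le_rfl
    · rw [Pi.single_eq_of_ne hj]
      exact contDiffOn_const
  eq_sum q hq := by
    have hev : v =ᶠ[𝓝 q] fun x => ∑ j, T j (x j) := by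
      filter_upwards [(isOpen_box hI).mem_nhds hq] with x hx using h.eq_sum x hx
    have hd : HasFDerivAt (fun x : Fin n → ℝ => ∑ j, T j (x j))
        (∑ j, deriv (T j) (q j) • ContinuousLinearMap.proj (R := ℝ) (φ := fun _ : Fin n => ℝ) j)
        q := by
      refine HasFDerivAt.fun_sum fun j _ => ?_
      have h1 : DifferentiableAt ℝ (T j) (q j) :=
        ((h.smooth j).contDiffAt ((hI j).mem_nhds (hq j trivial))).differentiableAt (by simp)
      exact h1.hasDerivAt.comp_hasFDerivAt q (ContinuousLinearMap.proj (R := ℝ)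
        (φ := fun _ : Fin n => ℝ) j).hasFDerivAt
    rw [NullSep.pderiv, hev.fderiv_eq, hd.fderiv, sum_apply]
    refine Finset.sum_congr rfl fun j _ => ?_
    rcases eq_or_ne j i with rfl | hj
    · simp
    · simp [Pi.single_eq_of_ne hj]

theorem SeparatedOn.pderiv_iterate (hI : ∀ i, IsOpen (I i)) (h : SeparatedOn I v T) (i : Fin n)
    (k : ℕ) : SeparatedOn I ((NullSep.pderiv i)^[k + 1] v) (Pi.single i (deriv^[k + 1] (T i))) := by
  induction k with
  | zero => exact h.pderiv hI i
  | succ k ih =>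
    rw [Function.iterate_succ_apply', Function.iterate_succ_apply' deriv]
    simpa using ih.pderiv hI i

theorem deriv_iterate_zero (k : ℕ) : deriv^[k] (0 : ℝ → ℝ) = 0 := by
  induction k with
  | zero => rfl
  | succ k ih => rw [Function.iterate_succ_apply', ih]; ext; simp

/-- A derivative in direction j kills all summands but the j-th. Hence the i-th summand survives
only if no other direction occurs; with no derivatives at all, every summand survives. -/
theorem SeparatedOn.foldr_pderiv (hI : ∀ i, IsOpen (I i)) (h : SeparatedOn I v T)
    (a : Fin n → ℕ) : ∀ L : List (Fin n), L.Nodup →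
    SeparatedOn I (L.foldr (fun i g => (NullSep.pderiv i)^[a i] g) v) (fun i =>
      if ∀ j ∈ L, j ≠ i → a j = 0 then deriv^[if i ∈ L then a i else 0] (T i) else 0)
  | [], _ => by simpa using h
  | j :: L, hL => by
    have ih := h.foldr_pderiv hI a L (List.nodup_cons.1 hL).2
    have hj : j ∉ L := (List.nodup_cons.1 hL).1
    rw [List.foldr_cons]
    rcases Nat.eq_zero_or_eq_succ_pred (a j) with h0 | h0
    · rw [h0, Function.iterate_zero, id]
      convert ih using 2 with i
      rcases eq_or_ne i j with rfl | hij
      · simp [hj, h0]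
      · simp [h0, hij]
    · rw [h0]
      convert ih.pderiv_iterate hI j (a j).pred using 2 with i
      rcases eq_or_ne i j with rfl | hij
      · rw [Pi.single_eq_same]
        simp only [hj, if_false, List.mem_cons, true_or, if_true, Function.iterate_zero, id,
          forall_eq_or_imp, ne_eq, not_true_eq_false, false_imp_iff, true_and]
        split_ifs
        · rw [h0, Nat.pred_succ]
        · rw [deriv_iterate_zero]
      · rw [Pi.single_eq_of_ne hij, if_neg]
        intro hall
        have := hall j (by simp) hij.symm
        omega

/-- Mixed derivatives of a separated function vanish, so the PDE on such functions is the equation H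
= 0 on M. -/
theorem fullJet_eq_incl_jet {l : ℕ} (hI : ∀ i, IsOpen (I i)) (h : SeparatedOn I v T)
    {q : Fin n → ℝ} (hq : q ∈ univ.pi I) : fullJet l v q = incl (jet l v q) := by
  refine Prod.ext rfl (funext fun α => ?_)
  have h1 := (h.foldr_pderiv hI (fun i => (α.1 i : ℕ)) (List.finRange n)
    (List.nodup_finRange n)).eq_sum q hq
  simp only [List.mem_finRange, if_true, forall_const] at h1
  change mpderiv α v q = _
  rw [mpderiv, h1]
  simp only [incl, jet]
  split_ifs with h0
  · rw [h.eq_sum q hq]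
    refine Finset.sum_congr rfl fun i _ => ?_
    rw [if_pos (fun j _ => h0 j), h0 i]
    rfl
  · refine Finset.sum_congr rfl fun i _ => ?_
    by_cases hi : ∀ j, j ≠ i → (α.1 j : ℕ) = 0
    · have hpos : 0 < (α.1 i : ℕ) := by
        by_contra hc
        refine h0 fun j => ?_
        rcases eq_or_ne j i with rfl | hj
        · omega
        · exact hi j hj
      rw [if_pos hi, dif_pos ⟨hpos, hi⟩, (h.pderiv_iterate hI i _).eq_sum q hq,
        Finset.sum_eq_single i]
      · rw [Pi.single_eq_same, Nat.sub_add_cancel hpos]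
      · intro j _ hj
        rw [Pi.single_eq_of_ne hj]
        rfl
      · simp
    · rw [if_neg hi, dif_neg fun hc => hi hc.2]
      rfl

end SeparatedFunctions

/-! ### Jets of separated families -/

section Families

variable {n : ℕ} {E : Type*} [NormedAddCommGroup E] [NormedSpace ℝ E]

/-- The components `(u, ∂ᵢᵏ u)` of the jet of `u(q, c) = ∑ᵢ Sᵢ(qⁱ, c)`. -/
def fibreJet (l : ℕ) (S : Fin n → ℝ × E → ℝ) (x : (Fin n → ℝ) × E) :
    ℝ × (Fin n → Fin l → ℝ) :=
  (∑ i, S i (x.1 i, x.2), fun i k => tderiv^[(k : ℕ) + 1] (S i) (x.1 i, x.2))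

variable {I : Fin n → Set ℝ} {C : Set E} {S : Fin n → ℝ × E → ℝ}

theorem contDiffOn_tderiv_iterate_box (hI : ∀ i, IsOpen (I i)) (hC : IsOpen C)
    (hS : ∀ i, ContDiffOn ℝ ∞ (S i) (I i ×ˢ C)) (i : Fin n) (k : ℕ) :
    ContDiffOn ℝ ∞ (fun x : (Fin n → ℝ) × E => tderiv^[k] (S i) (x.1 i, x.2))
      (univ.pi I ×ˢ C) :=
  (contDiffOn_tderiv_iterate ((hI i).prod hC) (hS i) k).comp (by fun_prop)
    fun _ hx => ⟨hx.1 i trivial, hx.2⟩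

theorem contDiffOn_fibreJet (l : ℕ) (hI : ∀ i, IsOpen (I i)) (hC : IsOpen C)
    (hS : ∀ i, ContDiffOn ℝ ∞ (S i) (I i ×ˢ C)) :
    ContDiffOn ℝ ∞ (fibreJet l S) (univ.pi I ×ˢ C) :=
  (ContDiffOn.sum fun i _ => contDiffOn_tderiv_iterate_box hI hC hS i 0).prodMk
    (contDiffOn_pi.2 fun i => contDiffOn_pi.2 fun k =>
      contDiffOn_tderiv_iterate_box hI hC hS i (k + 1))

theorem fderiv_tderiv_iterate_box_single (hI : ∀ i, IsOpen (I i)) (hC : IsOpen C)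
    (hS : ∀ i, ContDiffOn ℝ ∞ (S i) (I i ×ˢ C)) {x : (Fin n → ℝ) × E} (hx : x ∈ univ.pi I ×ˢ C)
    (i j : Fin n) (k : ℕ) :
    fderiv ℝ (fun x : (Fin n → ℝ) × E => tderiv^[k] (S j) (x.1 j, x.2)) x (Pi.single i 1, 0) =
      if j = i then tderiv^[k + 1] (S j) (x.1 j, x.2) else 0 := by
  have h1 : DifferentiableAt ℝ (tderiv^[k] (S j)) (x.1 j, x.2) :=
    ((contDiffOn_tderiv_iterate ((hI j).prod hC) (hS j) k).contDiffAt
      (((hI j).prod hC).mem_nhds ⟨hx.1 j trivial, hx.2⟩)).differentiableAt (by simp)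
  have h2 : HasFDerivAt (fun x : (Fin n → ℝ) × E => (x.1 j, x.2))
      (((ContinuousLinearMap.proj (R := ℝ) (φ := fun _ : Fin n => ℝ) j).comp
        (ContinuousLinearMap.fst ℝ _ E)).prod (ContinuousLinearMap.snd ℝ _ E)) x :=
    (((ContinuousLinearMap.proj (R := ℝ) (φ := fun _ : Fin n => ℝ) j).comp
      (ContinuousLinearMap.fst ℝ _ E)).prod (ContinuousLinearMap.snd ℝ _ E)).hasFDerivAt
  have h3 := (h1.hasFDerivAt.comp x h2).fderiv
  simp only [Function.comp_def] at h3
  rw [h3, Function.iterate_succ_apply']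
  split_ifs with hji
  · subst hji
    simp [tderiv]
  · have : ((0 : ℝ), (0 : E)) = 0 := rfl
    simp [Pi.single_eq_of_ne hji, this]

/-- Only S_i depends on q^i. The index k = 0 stands for the first derivative, so differentiating its
entry once more yields order k + 2. -/
theorem fderiv_fibreJet_single (l : ℕ) (hI : ∀ i, IsOpen (I i)) (hC : IsOpen C)
    (hS : ∀ i, ContDiffOn ℝ ∞ (S i) (I i ×ˢ C)) {x : (Fin n → ℝ) × E} (hx : x ∈ univ.pi I ×ˢ C)
    (i : Fin n) :
    fderiv ℝ (fibreJet l S) x (Pi.single i 1, 0) =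
      (tderiv (S i) (x.1 i, x.2),
        Pi.single i fun k : Fin l => tderiv^[(k : ℕ) + 2] (S i) (x.1 i, x.2)) := by
  have hx' := ((isOpen_box hI).prod hC).mem_nhds hx
  have hd : ∀ j k, DifferentiableAt ℝ
      (fun x : (Fin n → ℝ) × E => tderiv^[k] (S j) (x.1 j, x.2)) x := fun j k =>
    ((contDiffOn_tderiv_iterate_box hI hC hS j k).contDiffAt hx').differentiableAt (by simp)
  have h1 : HasFDerivAt (fun x : (Fin n → ℝ) × E => ∑ j, S j (x.1 j, x.2))
      (∑ j, fderiv ℝ (fun x : (Fin n → ℝ) × E => S j (x.1 j, x.2)) x) x :=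
    HasFDerivAt.fun_sum fun j _ => (hd j 0).hasFDerivAt
  have h2 : HasFDerivAt (fun (x : (Fin n → ℝ) × E) (j : Fin n) (k : Fin l) =>
      tderiv^[(k : ℕ) + 1] (S j) (x.1 j, x.2)) (ContinuousLinearMap.pi fun j =>
        ContinuousLinearMap.pi fun k : Fin l => fderiv ℝ (fun x : (Fin n → ℝ) × E =>
          tderiv^[(k : ℕ) + 1] (S j) (x.1 j, x.2)) x) x :=
    hasFDerivAt_pi.2 fun j => hasFDerivAt_pi.2 fun k => (hd j _).hasFDerivAt
  have h3 : fderiv ℝ (fibreJet l S) x = _ := (h1.prodMk h2).fderiv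
  rw [h3]
  refine Prod.ext ?_ (funext fun j => funext fun k => ?_)
  · rw [ContinuousLinearMap.prod_apply, sum_apply, Finset.sum_eq_single i]
    · exact (fderiv_tderiv_iterate_box_single hI hC hS hx i i 0).trans (if_pos rfl)
    · intro j _ hj
      exact (fderiv_tderiv_iterate_box_single hI hC hS hx i j 0).trans (if_neg hj)
    · simp
  · change fderiv ℝ (fun x : (Fin n → ℝ) × E => tderiv^[(k : ℕ) + 1] (S j) (x.1 j, x.2)) x
      (Pi.single i 1, 0) = (Pi.single i _ : Fin n → Fin l → ℝ) j k
    rw [fderiv_tderiv_iterate_box_single hI hC hS hx]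
    split_ifs with hj
    · subst hj
      simp
    · simp [Pi.single_eq_of_ne hj]

variable {u : (Fin n → ℝ) → E → ℝ}

theorem separatedOn_slice (hS : ∀ i, ContDiffOn ℝ ∞ (S i) (I i ×ˢ C))
    (hu : ∀ q ∈ univ.pi I, ∀ c ∈ C, u q c = ∑ i, S i (q i, c)) {c : E} (hc : c ∈ C) :
    SeparatedOn I (fun q => u q c) (fun i s => S i (s, c)) where
  smooth i := (hS i).comp (by fun_prop) fun _ hs => ⟨hs, hc⟩
  eq_sum q hq := hu q hq c hc

theorem jet_eq_fibreJet (l : ℕ) (hI : ∀ i, IsOpen (I i)) (hC : IsOpen C)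
    (hS : ∀ i, ContDiffOn ℝ ∞ (S i) (I i ×ˢ C))
    (hu : ∀ q ∈ univ.pi I, ∀ c ∈ C, u q c = ∑ i, S i (q i, c)) {q : Fin n → ℝ}
    (hq : q ∈ univ.pi I) {c : E} (hc : c ∈ C) :
    jet l (fun x => u x c) q = (q, fibreJet l S (q, c)) := by
  have hsep := separatedOn_slice hS hu hc
  refine Prod.ext rfl (Prod.ext (hu q hq c hc) (funext fun i => funext fun k => ?_))
  simp only [jet, fibreJet]
  rw [(hsep.pderiv_iterate hI i k).eq_sum q hq, Finset.sum_eq_single i]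
  · rw [Pi.single_eq_same]
    exact deriv_iterate_eq_tderiv ((hI i).prod hC) (hS i) _ ⟨hq i trivial, hc⟩
  · intro j _ hj
    rw [Pi.single_eq_of_ne hj]
    rfl
  · simp

end Families

/-! ### The rank condition as injectivity of the parameter derivative -/

section Rank

variable {n l m : ℕ}

theorem clm_apply_eq_sum (L : (Fin m → ℝ) →L[ℝ] ℝ) (x : Fin m → ℝ) :
    L x = ∑ a, L (Pi.single a 1) * x a := by
  conv_lhs => rw [← Finset.univ_sum_single x, map_sum]
  refine Finset.sum_congr rfl fun a _ => ?_
  rw [show Pi.single a (x a) = x a • (Pi.single a 1 : Fin m → ℝ) by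
    rw [← Pi.single_smul, smul_eq_mul, mul_one], map_smul, smul_eq_mul, mul_comm]

/-- The transposed matrix represents D, and rank–nullity does the rest. The fibre component `g` is
arbitrary so that families with substituted parameters are covered too. -/
theorem rank_paramMatrix_iff {u : (Fin n → ℝ) → (Fin m → ℝ) → ℝ} {q : Fin n → ℝ} {c : Fin m → ℝ}
    {g : (Fin m → ℝ) → ℝ × (Fin n → Fin l → ℝ)}
    (hg : ∀ᶠ c' in 𝓝 c, jet l (fun x => u x c') q = (q, g c'))
    {D : (Fin m → ℝ) →L[ℝ] ℝ × (Fin n → Fin l → ℝ)} (hD : HasFDerivAt g D c) :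
    (paramMatrix l u q c).rank = m ↔ Function.Injective D := by
  have h0 : fderiv ℝ (fun c' => (jet l (fun x => u x c') q).2.1) c =
      (ContinuousLinearMap.fst ℝ ℝ _).comp D := by
    have hev : (fun c' => (jet l (fun x => u x c') q).2.1) =ᶠ[𝓝 c] fun c' => (g c').1 := by
      filter_upwards [hg] with c' hc'
      rw [hc']
    rw [hev.fderiv_eq]
    exact hD.fst.fderiv
  have h1 : ∀ (i : Fin n) (k : Fin l),
      fderiv ℝ (fun c' => (jet l (fun x => u x c') q).2.2 i k) c =
      (ContinuousLinearMap.proj (R := ℝ) (φ := fun _ : Fin l => ℝ) k).comp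
        ((ContinuousLinearMap.proj (R := ℝ) (φ := fun _ : Fin n => Fin l → ℝ) i).comp
          ((ContinuousLinearMap.snd ℝ ℝ _).comp D)) := by
    intro i k
    have hev : (fun c' => (jet l (fun x => u x c') q).2.2 i k) =ᶠ[𝓝 c]
        fun c' => (g c').2 i k := by
      filter_upwards [hg] with c' hc'
      rw [hc']
    rw [hev.fderiv_eq]
    exact (hasFDerivAt_pi'.1 (hasFDerivAt_pi'.1 hD.snd i) k).fderiv
  have hmul : ∀ x, (paramMatrix l u q c).transpose.mulVecLin x =
      fun A => match A with
        | none => (D x).1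
        | some (i, k) => (D x).2 i k := by
    intro x
    ext A
    rw [Matrix.mulVecLin_apply, Matrix.mulVec, dotProduct]
    match A with
    | none =>
      simp only [Matrix.transpose_apply, paramMatrix, Matrix.of_apply, h0]
      exact (clm_apply_eq_sum _ x).symm
    | some (i, k) =>
      simp only [Matrix.transpose_apply, paramMatrix, Matrix.of_apply, h1]
      exact (clm_apply_eq_sum _ x).symm
  have hker : LinearMap.ker (paramMatrix l u q c).transpose.mulVecLin =
      LinearMap.ker (D : (Fin m → ℝ) →ₗ[ℝ] ℝ × (Fin n → Fin l → ℝ)) := by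
    ext x
    rw [LinearMap.mem_ker, LinearMap.mem_ker, hmul, ContinuousLinearMap.coe_coe]
    constructor
    · intro h
      exact Prod.ext (congrFun h none) (funext fun i => funext fun k => congrFun h (some (i, k)))
    · intro h
      ext A
      match A with
      | none => simp [h]
      | some (i, k) => simp [h]
  have hrn := LinearMap.finrank_range_add_finrank_ker (paramMatrix l u q c).transpose.mulVecLin
  rw [← Matrix.rank_transpose, Matrix.rank]
  rw [Module.finrank_fin_fun, hker] at hrn
  constructor
  · intro h
    have h2 : Module.finrank ℝ (LinearMap.ker (D : (Fin m → ℝ) →ₗ[ℝ] ℝ × (Fin n → Fin l → ℝ))) = 0 := by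
      omega
    exact LinearMap.ker_eq_bot.1 (Submodule.finrank_eq_zero.1 h2)
  · intro h
    rw [LinearMap.ker_eq_bot.2 h, finrank_bot] at hrn
    omega

end Rank

/-! ### Internal and extended solutions -/

section Solutions

section Polynomials

open Polynomial

theorem deriv_iterate_polynomial (p : ℝ[X]) (k : ℕ) :
    deriv^[k] (fun t => p.eval t) = fun t => (derivative^[k] p).eval t := by
  induction k with
  | zero => rfl
  | succ k ih =>
    rw [Function.iterate_succ_apply', ih, Function.iterate_succ_apply']
    ext t
    simp

theorem exists_polynomial_deriv_iterate (a : ℝ) (l : ℕ) (w : ℕ → ℝ) :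
    ∃ p : ℝ[X], ∀ k ≤ l, deriv^[k] (fun t => p.eval t) a = w k := by
  -- The polynomial with coefficients w_j / j!, recentred from 0 to a.
  refine ⟨taylor (-a) (∑ j ∈ Finset.range (l + 1), C (w j / j.factorial) * X ^ j), fun k hk => ?_⟩
  rw [deriv_iterate_polynomial]
  beta_reduce
  rw [← factorial_smul_hasseDeriv, LinearMap.smul_apply, eval_smul, ← taylor_coeff,
    taylor_taylor]
  simp only [add_neg_cancel, taylor_zero, finsetSum_coeff, coeff_C_mul_X_pow]
  rw [Finset.sum_eq_single k]
  · have : (k.factorial : ℝ) ≠ 0 := by positivity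
    simp
    field_simp
  · intro j _ hj
    rw [if_neg hj.symm]
  · intro h
    simp at h
    omega

end Polynomials

section Parameters

/-- `c ↦ (c, 0)`. -/
def snocZero (m : ℕ) : (Fin m → ℝ) →L[ℝ] (Fin (m + 1) → ℝ) :=
  ContinuousLinearMap.pi fun j => Fin.lastCases 0 (fun i => ContinuousLinearMap.proj i) j

/-- `(c, e) ↦ c`. -/
def initL (m : ℕ) : (Fin (m + 1) → ℝ) →L[ℝ] (Fin m → ℝ) :=
  ContinuousLinearMap.pi fun j => ContinuousLinearMap.proj j.castSucc

/-- `(c, e) ↦ e`. -/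
def lastL (m : ℕ) : (Fin (m + 1) → ℝ) →L[ℝ] ℝ := ContinuousLinearMap.proj (Fin.last m)

@[simp]
theorem snocZero_last (m : ℕ) (c : Fin m → ℝ) : snocZero m c (Fin.last m) = 0 := by
  simp [snocZero]

@[simp]
theorem lastL_apply (m : ℕ) (c : Fin (m + 1) → ℝ) : lastL m c = c (Fin.last m) := rfl

@[simp]
theorem initL_snocZero (m : ℕ) (c : Fin m → ℝ) : initL m (snocZero m c) = c := by
  ext j
  simp [snocZero, initL]

theorem eq_zero_of_initL_of_last {m : ℕ} {c : Fin (m + 1) → ℝ} (h1 : initL m c = 0)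
    (h2 : c (Fin.last m) = 0) : c = 0 := by
  ext j
  refine Fin.lastCases h2 (fun i => ?_) j
  exact congrFun h1 i

end Parameters

variable {n l : ℕ}

section FibreDerivative

variable {m : ℕ} {I : Fin n → Set ℝ} {C : Set (Fin m → ℝ)} {S : Fin n → ℝ × (Fin m → ℝ) → ℝ}

/-- The derivative of `fibreJet` in the direction of the parameters. -/
def paramDeriv (l : ℕ) (S : Fin n → ℝ × (Fin m → ℝ) → ℝ) (x : (Fin n → ℝ) × (Fin m → ℝ)) :
    (Fin m → ℝ) →L[ℝ] ℝ × (Fin n → Fin l → ℝ) :=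
  (fderiv ℝ (fibreJet l S) x).comp (ContinuousLinearMap.inr ℝ _ _)

theorem hasFDerivAt_paramDeriv (l : ℕ) (hI : ∀ i, IsOpen (I i)) (hC : IsOpen C)
    (hS : ∀ i, ContDiffOn ℝ ∞ (S i) (I i ×ˢ C)) {q : Fin n → ℝ} (hq : q ∈ univ.pi I)
    {c : Fin m → ℝ} (hc : c ∈ C) :
    HasFDerivAt (fun c' => fibreJet l S (q, c')) (paramDeriv l S (q, c)) c :=
  ((contDiffOn_fibreJet l hI hC hS).contDiffAt (((isOpen_box hI).prod hC).mem_nhds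
    ⟨hq, hc⟩)).differentiableAt (by simp) |>.hasFDerivAt.comp c (hasFDerivAt_prodMk_right q c)

theorem rank_paramMatrix_iff_injective {u : (Fin n → ℝ) → (Fin m → ℝ) → ℝ}
    (hI : ∀ i, IsOpen (I i)) (hC : IsOpen C)
    (hS : ∀ i, ContDiffOn ℝ ∞ (S i) (I i ×ˢ C))
    (hu : ∀ q ∈ univ.pi I, ∀ c ∈ C, u q c = ∑ i, S i (q i, c)) {q : Fin n → ℝ}
    (hq : q ∈ univ.pi I) {c : Fin m → ℝ} (hc : c ∈ C) :
    (paramMatrix l u q c).rank = m ↔ Function.Injective (paramDeriv l S (q, c)) :=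
  rank_paramMatrix_iff (by
    filter_upwards [hC.mem_nhds hc] with c' hc' using jet_eq_fibreJet l hI hC hS hu hq hc')
    (hasFDerivAt_paramDeriv l hI hC hS hq hc)

end FibreDerivative

section Constructions

variable {U : Set (FullJet n l)} {𝓗 : FullJet n l → ℝ} {P : M n l}

theorem IsSeparatedFamily.exists_uncurried {m : ℕ} {I : Fin n → Set ℝ} {C : Set (Fin m → ℝ)}
    {u : (Fin n → ℝ) → (Fin m → ℝ) → ℝ} (h : IsSeparatedFamily I C u) :
    ∃ S : Fin n → ℝ × (Fin m → ℝ) → ℝ, (∀ i, ContDiffOn ℝ ∞ (S i) (I i ×ˢ C)) ∧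
      ∀ q ∈ univ.pi I, ∀ c ∈ C, u q c = ∑ i, S i (q i, c) := by
  obtain ⟨-, -, S, hS, hu⟩ := h
  exact ⟨fun i x => S i x.1 x.2, hS, hu⟩

/-- A separated family with a nondegenerate parameter matrix at one point gives, locally,
an extended solution. -/
theorem hasExtendedSolutionAt_of_fibreJet {I : Fin n → Set ℝ} {C : Set (Fin (n * l + 1) → ℝ)}
    {S : Fin n → ℝ × (Fin (n * l + 1) → ℝ) → ℝ} (hI : ∀ i, IsOpen (I i)) (hC : IsOpen C)
    (hS : ∀ i, ContDiffOn ℝ ∞ (S i) (I i ×ˢ C))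
    (hsol : ∀ q ∈ univ.pi I, ∀ c ∈ C, c (Fin.last (n * l)) = 0 →
      incl (q, fibreJet l S (q, c)) ∈ U ∧ reduced 𝓗 (q, fibreJet l S (q, c)) = 0)
    {q₀ : Fin n → ℝ} (hq₀ : q₀ ∈ univ.pi I) {c₀ : Fin (n * l + 1) → ℝ} (hc₀ : c₀ ∈ C)
    (hlast : c₀ (Fin.last (n * l)) = 0) (hP : (q₀, fibreJet l S (q₀, c₀)) = P)
    (hinj : Function.Injective (paramDeriv l S (q₀, c₀))) : HasExtendedSolutionAt U 𝓗 P := by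
  have hB := (isOpen_box hI).prod hC
  have hcont : ContinuousOn (paramDeriv l S) (univ.pi I ×ˢ C) :=
    ((contDiffOn_fibreJet l hI hC hS).continuousOn_fderiv_of_isOpen hB (by simp)).clm_comp
      continuousOn_const
  -- Injectivity at one point persists on a box around it; the family is restricted to that box.
  have hopen := hcont.isOpen_inter_preimage hB isOpen_setOf_injective
  obtain ⟨r, hr, hball⟩ := Metric.isOpen_iff.1 hopen (q₀, c₀) ⟨⟨hq₀, hc₀⟩, hinj⟩
  rw [← ball_prod_same, ball_pi _ hr] at hball
  set I' : Fin n → Set ℝ := fun i => ball (q₀ i) r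
  set C' : Set (Fin (n * l + 1) → ℝ) := ball c₀ r
  have hI' : ∀ i, IsOpen (I' i) := fun i => isOpen_ball
  have hq₀' : q₀ ∈ univ.pi I' := fun i _ => mem_ball_self hr
  have hc₀' : c₀ ∈ C' := mem_ball_self hr
  have hsub : ∀ q ∈ univ.pi I', ∀ c ∈ C', q ∈ univ.pi I ∧ c ∈ C := fun q hq c hc =>
    (hball (⟨hq, hc⟩ : (q, c) ∈ univ.pi I' ×ˢ C')).1
  have hS' : ∀ i, ContDiffOn ℝ ∞ (S i) (I' i ×ˢ C') := fun i => by
    refine (hS i).mono fun x hx => ?_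
    have hq : Function.update q₀ i x.1 ∈ univ.pi I' := by
      intro j _
      rcases eq_or_ne j i with rfl | hj
      · simpa using hx.1
      · rw [Function.update_of_ne hj]
        exact mem_ball_self (x := q₀ j) hr
    have := (hsub _ hq _ hx.2)
    exact ⟨by simpa using this.1 i trivial, this.2⟩
  set u : (Fin n → ℝ) → (Fin (n * l + 1) → ℝ) → ℝ := fun q c => ∑ i, S i (q i, c)
  have hu : ∀ q ∈ univ.pi I', ∀ c ∈ C', u q c = ∑ i, S i (q i, c) := fun _ _ _ _ => rfl
  have hjet : ∀ q ∈ univ.pi I', ∀ c ∈ C', jet l (fun x => u x c) q = (q, fibreJet l S (q, c)) :=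
    fun q hq c hc => jet_eq_fibreJet l hI' isOpen_ball hS' hu hq hc
  refine ⟨I', C', u, ⟨⟨hI', isOpen_ball, fun i t c => S i (t, c), hS', hu⟩, ?_, ?_⟩,
    q₀, hq₀', c₀, hc₀', hlast, (hjet q₀ hq₀' c₀ hc₀').trans hP⟩
  · intro q hq c hc h0
    rw [fullJet_eq_incl_jet hI' (separatedOn_slice hS' hu hc) hq, hjet q hq c hc]
    exact hsol q (hsub q hq c hc).1 c (hsub q hq c hc).2 h0
  · intro q hq c hc
    rw [rank_paramMatrix_iff_injective hI' isOpen_ball hS' hu hq hc]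
    exact (hball (⟨hq, hc⟩ : (q, c) ∈ univ.pi I' ×ˢ C')).2

/-- The last parameter is frozen at 0; the derivative stays injective when composed with the
injection c ↦ (c, 0). -/
theorem HasExtendedSolutionAt.hasInternalSolutionAt (h : HasExtendedSolutionAt U 𝓗 P) :
    HasInternalSolutionAt U 𝓗 P := by
  obtain ⟨I, C, u, hu, q₀, hq₀, c₀, hc₀, hlast, hP⟩ := h
  obtain ⟨S, hS, huS⟩ := hu.separated.exists_uncurried
  obtain ⟨hI, hC, -⟩ := hu.separated
  set σ := snocZero (n * l)
  have hσ : σ (initL (n * l) c₀) = c₀ := by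
    ext j
    refine Fin.lastCases ?_ (fun i => ?_) j
    · simp [σ, hlast]
    · simp [σ, snocZero, initL]
  refine ⟨I, σ ⁻¹' C, fun q c => u q (σ c), ⟨⟨hI, hC.preimage σ.continuous,
    fun i t c => S i (t, σ c), fun i => ?_, fun q hq c hc => huS q hq _ hc⟩, ?_, ?_⟩,
    q₀, hq₀, initL _ c₀, by rwa [mem_preimage, hσ], by simpa only [hσ] using hP⟩
  · exact (hS i).comp (by fun_prop) fun x hx => ⟨hx.1, hx.2⟩
  · exact fun q hq c hc => hu.solution q hq (σ c) hc (snocZero_last _ _)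
  · intro q hq c hc
    have hinj := (rank_paramMatrix_iff_injective hI hC hS huS hq hc).1 (hu.complete q hq _ hc)
    refine (rank_paramMatrix_iff (g := fun c' => fibreJet l S (q, σ c')) ?_
      ((hasFDerivAt_paramDeriv l hI hC hS hq hc).comp c σ.hasFDerivAt)).2 ?_
    · filter_upwards [(hC.preimage σ.continuous).mem_nhds hc] with c' hc'
      exact jet_eq_fibreJet l hI hC hS huS hq hc'
    · exact hinj.comp (Function.LeftInverse.injective (initL_snocZero _))

theorem tderiv_iterate_add_last_mul {m : ℕ} {J : Set ℝ} {C : Set (Fin m → ℝ)} (hJ : IsOpen J)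
    (hC : IsOpen C) {f : ℝ × (Fin m → ℝ) → ℝ} (hf : ContDiffOn ℝ ∞ f (J ×ˢ C)) {g : ℝ → ℝ}
    (hg : ContDiff ℝ ∞ g) (k : ℕ) {t : ℝ} (ht : t ∈ J) {c : Fin (m + 1) → ℝ}
    (hc : initL m c ∈ C) :
    tderiv^[k] (fun x : ℝ × (Fin (m + 1) → ℝ) => f (x.1, initL m x.2) + lastL m x.2 * g x.1) (t, c) =
      tderiv^[k] f (t, initL m c) + lastL m c * deriv^[k] g t := by
  have hC' := hC.preimage (initL m).continuous
  have hF : ContDiffOn ℝ ∞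
      (fun x : ℝ × (Fin (m + 1) → ℝ) => f (x.1, initL m x.2) + lastL m x.2 * g x.1)
      (J ×ˢ (initL m ⁻¹' C)) := by
    refine ContDiffOn.add (hf.comp (by fun_prop) fun x hx => ⟨hx.1, hx.2⟩) ?_
    exact ContDiff.contDiffOn (by fun_prop)
  rw [← deriv_iterate_eq_tderiv (hJ.prod hC') hF k ⟨ht, hc⟩,
    ← deriv_iterate_eq_tderiv (hJ.prod hC) hf k ⟨ht, hc⟩]
  have h1 : ContDiffOn ℝ ∞ (fun s => f (s, initL m c)) J :=
    hf.comp (by fun_prop) fun s hs => ⟨hs, hc⟩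
  simp only [← iteratedDeriv_eq_iterate]
  rw [← Pi.add_def, iteratedDeriv_add, iteratedDeriv_const_mul_field]
  · exact (h1.contDiffAt (hJ.mem_nhds ht)).of_le (by exact_mod_cast le_top)
  · exact ContDiffAt.of_le (n := ∞) (by fun_prop) (by exact_mod_cast le_top)

/-- A term e·∑ p_i(q^i) is added, e being the new parameter. It does not affect the members with e =
0, and it makes the parameter derivative injective at one point if the jet of ∑ p_i there is
transverse to the old image. -/
theorem HasInternalSolutionAt.hasExtendedSolutionAt [NeZero n]
    (h : HasInternalSolutionAt U 𝓗 P) : HasExtendedSolutionAt U 𝓗 P := by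
  obtain ⟨I, C, u, hu, q₀, hq₀, c₀, hc₀, hP⟩ := h
  obtain ⟨S, hS, huS⟩ := hu.separated.exists_uncurried
  obtain ⟨hI, hC, -⟩ := hu.separated
  have hinj := (rank_paramMatrix_iff_injective hI hC hS huS hq₀ hc₀).1 (hu.complete q₀ hq₀ _ hc₀)
  set D := paramDeriv l S (q₀, c₀)
  -- The source has dimension nl, the target nl + 1.
  obtain ⟨w, hw⟩ : ∃ w, w ∉ range D := by
    by_contra! hcon
    have h1 := (LinearEquiv.ofBijective (D : (Fin (n * l) → ℝ) →ₗ[ℝ] ℝ × (Fin n → Fin l → ℝ))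
      ⟨hinj, fun w => hcon w⟩).finrank_eq
    simp [Module.finrank_prod, Module.finrank_pi_fintype] at h1
  -- For k = 0 each p_i takes the value w.1 / n, so that the n values add up to the u-component of
  -- w.
  have hex : ∀ i, ∃ p : Polynomial ℝ, ∀ k ≤ l, deriv^[k] (fun t => p.eval t) (q₀ i) =
      if h : 0 < k ∧ k - 1 < l then w.2 i ⟨k - 1, h.2⟩ else w.1 / n :=
    fun i => exists_polynomial_deriv_iterate (q₀ i) l _
  choose p hp using hex
  set S' : Fin n → ℝ × (Fin (n * l + 1) → ℝ) → ℝ := fun i x =>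
    S i (x.1, initL (n * l) x.2) + lastL (n * l) x.2 * (p i).eval x.1
  have hpc : ∀ i, ContDiff ℝ ∞ fun t => (p i).eval t := fun i => by
    simpa [Polynomial.coe_aeval_eq_eval] using (p i).contDiff_aeval (R := ℝ) (𝕜 := ℝ) ∞
  have hC' := hC.preimage (initL (n * l)).continuous
  have hS' : ∀ i, ContDiffOn ℝ ∞ (S' i) (I i ×ˢ (initL (n * l) ⁻¹' C)) := fun i => by
    refine ContDiffOn.add ((hS i).comp (by fun_prop) fun x hx => ⟨hx.1, hx.2⟩) ?_
    have := hpc i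
    exact ContDiff.contDiffOn (by fun_prop)
  have hfib : ∀ q ∈ univ.pi I, ∀ c ∈ initL (n * l) ⁻¹' C, fibreJet l S' (q, c) =
      fibreJet l S (q, initL (n * l) c) + lastL (n * l) c •
        ((∑ i, (p i).eval (q i), fun i k => deriv^[(k : ℕ) + 1] (fun t => (p i).eval t) (q i)) :
          ℝ × (Fin n → Fin l → ℝ)) := by
    intro q hq c hc
    refine Prod.ext ?_ (funext fun i => funext fun k => ?_)
    · simp [fibreJet, S', Finset.sum_add_distrib, Finset.mul_sum]
    · exact tderiv_iterate_add_last_mul (hI i) hC (hS i) (hpc i) _ (hq i trivial) hc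
  have hwq : ((∑ i, (p i).eval (q₀ i), fun i k => deriv^[(k : ℕ) + 1] (fun t => (p i).eval t) (q₀ i)) :
          ℝ × (Fin n → Fin l → ℝ)) = w := by
    refine Prod.ext ?_ (funext fun i => funext fun k => ?_)
    · have h0 : ∀ i, (p i).eval (q₀ i) = w.1 / n := fun i => by simpa using hp i 0 (Nat.zero_le _)
      have : (n : ℝ) ≠ 0 := NeZero.ne _
      simp only [h0, Finset.sum_const, Finset.card_univ, Fintype.card_fin, nsmul_eq_mul]
      field_simp
    · have := hp i (k + 1) k.2
      rw [dif_pos ⟨Nat.succ_pos _, k.2⟩] at this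
      exact this
  have hlast0 : ∀ q ∈ univ.pi I, ∀ c ∈ initL (n * l) ⁻¹' C, c (Fin.last (n * l)) = 0 →
      fibreJet l S' (q, c) = fibreJet l S (q, initL (n * l) c) := fun q hq c hc h0 => by
    rw [hfib q hq c hc, lastL_apply, h0, zero_smul, add_zero]
  have hc₀' : snocZero (n * l) c₀ ∈ initL (n * l) ⁻¹' C := by simpa using hc₀
  refine hasExtendedSolutionAt_of_fibreJet (S := S') hI hC' hS' ?_ hq₀ hc₀' (snocZero_last _ _) ?_ ?_
  · intro q hq c hc h0
    rw [hlast0 q hq c hc h0, ← jet_eq_fibreJet l hI hC hS huS hq hc, reduced,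
      ← fullJet_eq_incl_jet hI (separatedOn_slice hS huS hc) hq]
    exact hu.solution q hq _ hc
  · rw [hlast0 q₀ hq₀ _ hc₀' (snocZero_last _ _), initL_snocZero,
      ← jet_eq_fibreJet l hI hC hS huS hq₀ hc₀, hP]
  · have hD : HasFDerivAt (fun c => fibreJet l S' (q₀, c))
        (D.comp (initL (n * l)) + (lastL (n * l)).smulRight w) (snocZero (n * l) c₀) := by
      have h1 : HasFDerivAt (fun c => fibreJet l S (q₀, c)) D (initL (n * l) (snocZero (n * l) c₀)) := by
        rw [initL_snocZero]
        exact hasFDerivAt_paramDeriv l hI hC hS hq₀ hc₀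
      refine ((h1.comp _ (initL (n * l)).hasFDerivAt).add
        ((lastL (n * l)).hasFDerivAt.smul_const w)).congr_of_eventuallyEq ?_
      filter_upwards [hC'.mem_nhds hc₀'] with c hc
      rw [hfib q₀ hq₀ c hc, hwq]
      rfl
    rw [(hasFDerivAt_paramDeriv l hI hC' hS' hq₀ hc₀').unique hD, injective_iff_map_eq_zero]
    intro d hd
    have hd' : D (initL (n * l) d) + d (Fin.last (n * l)) • w = 0 := hd
    have hd0 : d (Fin.last (n * l)) = 0 := by
      by_contra hne
      refine hw ⟨-(d (Fin.last (n * l)))⁻¹ • initL (n * l) d, ?_⟩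
      rw [map_smul, eq_neg_of_add_eq_zero_left hd', smul_neg, neg_smul, neg_neg, smul_smul,
        inv_mul_cancel₀ hne, one_smul]
    rw [hd0, zero_smul, add_zero] at hd'
    exact eq_zero_of_initL_of_last (hinj (hd'.trans (map_zero D).symm)) hd0

end Constructions

end Solutions

/-! ### The vector fields D_i, and the necessity of the conditions -/

section Conditions

variable {n l : ℕ}

section Smoothness

theorem contDiff_incl : ContDiff ℝ ∞ (incl : M n l → FullJet n l) := by
  refine contDiff_fst.prodMk (contDiff_pi.2 fun α => ?_)
  by_cases h0 : ∀ j, (α.1 j : ℕ) = 0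
  · simp only [h0, implies_true, if_true]
    fun_prop
  · simp only [h0, if_false]
    refine ContDiff.sum fun i _ => ?_
    by_cases hi : 0 < (α.1 i : ℕ) ∧ ∀ j, j ≠ i → (α.1 j : ℕ) = 0
    · simp only [dif_pos hi]
      fun_prop
    · simp only [dif_neg hi]
      fun_prop

variable {U : Set (FullJet n l)} {𝓗 : FullJet n l → ℝ}

theorem isOpen_incl_preimage (hU : IsOpen U) : IsOpen (incl ⁻¹' U : Set (M n l)) :=
  hU.preimage contDiff_incl.continuous

theorem contDiffOn_reduced (h𝓗 : ContDiffOn ℝ ∞ 𝓗 U) :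
    ContDiffOn ℝ ∞ (reduced 𝓗) (incl ⁻¹' U : Set (M n l)) :=
  h𝓗.comp contDiff_incl.contDiffOn fun _ hp => hp

variable [NeZero l] {R : Fin n → M n l → ℝ} {V : Set (M n l)}

theorem contDiffOn_genVec (hR : ∀ i, ContDiffOn ℝ ∞ (R i) V) (i : Fin n) :
    ContDiffOn ℝ ∞ (genVec R i) V := by
  refine contDiffOn_const.prodMk (ContDiffOn.prodMk (ContDiff.contDiffOn (by fun_prop)) ?_)
  refine contDiffOn_pi.2 fun j => ?_
  rcases eq_or_ne j i with rfl | hj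
  · simp only [Pi.single_eq_same]
    refine contDiffOn_pi.2 fun k => ?_
    by_cases hk : (k : ℕ) + 1 < l
    · simp only [dif_pos hk]
      exact ContDiff.contDiffOn (by fun_prop)
    · simp only [dif_neg hk]
      exact hR j
  · simp only [Pi.single_eq_of_ne hj]
    exact contDiffOn_const

theorem contDiffOn_gen (hV : IsOpen V) (hR : ∀ i, ContDiffOn ℝ ∞ (R i) V) {F : M n l → ℝ}
    (hF : ContDiffOn ℝ ∞ F V) (i : Fin n) : ContDiffOn ℝ ∞ (gen R i F) V :=
  (hF.fderiv_of_isOpen hV (m := ∞) le_rfl).clm_apply (contDiffOn_genVec hR i)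

/-- The coordinate vector `∂/∂uᵢ⁽ˡ⁾`. -/
def topVec (i : Fin n) : M n l := (0, 0, Pi.single i (Pi.single (Fin.ofNat l (l - 1)) 1))

theorem eq_ofNat_iff (k : Fin l) : k = Fin.ofNat l (l - 1) ↔ ¬ (k : ℕ) + 1 < l := by
  have hl : 0 < l := Nat.pos_of_ne_zero (NeZero.ne l)
  rw [Fin.ext_iff, Fin.val_ofNat, Nat.mod_eq_of_lt (by omega)]
  have := k.2
  omega

/-- Vectors which agree with `genVec` except for the top component. -/
theorem genVec_add_smul_topVec (R R' : Fin n → M n l → ℝ) (i : Fin n) (p p' : M n l)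
    (hp : p.2.2 i = p'.2.2 i) :
    genVec R' i p' = genVec R i p + (R' i p' - R i p) • topVec i := by
  refine Prod.ext (by simp [genVec, topVec]) (Prod.ext (by simp [genVec, topVec, hp])
    (funext fun j => ?_))
  rcases eq_or_ne j i with rfl | hj
  · ext k
    simp only [genVec, topVec, hp, Prod.snd_add, Prod.smul_snd, Pi.add_apply, Pi.smul_apply,
      Pi.single_eq_same, smul_eq_mul]
    by_cases hk : (k : ℕ) + 1 < l
    · have := mt (eq_ofNat_iff k).1 (not_not.2 hk)
      simp only [dif_pos hk, Pi.single_eq_of_ne this, mul_zero, add_zero]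
    · have := (eq_ofNat_iff k).2 hk
      simp only [dif_neg hk]
      rw [this]
      simp
  · simp [genVec, topVec, Pi.single_eq_of_ne hj]

/-- A change of R_i moves D_i only along ∂/∂u_i^{(l)}. This serves both to modify R_i and to compare
D_i with the true derivative along a family. -/
theorem gen_eq_add_topDeriv (R R' : Fin n → M n l → ℝ) (i : Fin n) (F : M n l → ℝ) (p : M n l) :
    gen R' i F p = gen R i F p + (R' i p - R i p) * topDeriv i F p := by
  rw [gen, genVec_add_smul_topVec R R' i p p rfl, map_add, map_smul, smul_eq_mul]
  rfl

/-- The jet map of a separated family carries ∂/∂q^i to D_i, with R_i the (l+1)-st derivative of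
S_i. -/
theorem prod_fderiv_fibreJet_single {E : Type*} [NormedAddCommGroup E] [NormedSpace ℝ E]
    {I : Fin n → Set ℝ} {C : Set E} {S : Fin n → ℝ × E → ℝ} (hI : ∀ i, IsOpen (I i))
    (hC : IsOpen C) (hS : ∀ i, ContDiffOn ℝ ∞ (S i) (I i ×ˢ C)) {x : (Fin n → ℝ) × E}
    (hx : x ∈ univ.pi I ×ˢ C) (i : Fin n) :
    (ContinuousLinearMap.fst ℝ _ _).prod (fderiv ℝ (fibreJet l S) x) (Pi.single i 1, 0) =
      genVec (fun _ _ => tderiv^[l + 1] (S i) (x.1 i, x.2)) i (x.1, fibreJet l S x) := by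
  refine Prod.ext rfl ?_
  rw [ContinuousLinearMap.prod_apply]
  simp only [fderiv_fibreJet_single l hI hC hS hx]
  refine Prod.ext rfl (congrArg (Pi.single i) (funext fun k => ?_))
  split_ifs with hk
  · rfl
  · have : (k : ℕ) + 2 = l + 1 := by have := k.2; omega
    rw [this]

theorem contDiffOn_topDeriv (hV : IsOpen V) {F : M n l → ℝ} (hF : ContDiffOn ℝ ∞ F V)
    (i : Fin n) : ContDiffOn ℝ ∞ (topDeriv i F) V :=
  (hF.fderiv_of_isOpen hV (m := ∞) le_rfl).clm_apply contDiffOn_const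

theorem gen_mul {F G : M n l → ℝ} {p : M n l} (hF : DifferentiableAt ℝ F p)
    (hG : DifferentiableAt ℝ G p) (i : Fin n) :
    gen R i (fun p' => F p' * G p') p = F p * gen R i G p + G p * gen R i F p := by
  have h : fderiv ℝ (fun p' => F p' * G p') p = F p • fderiv ℝ G p + G p • fderiv ℝ F p :=
    fderiv_fun_mul hF hG
  simp only [gen, h]
  rfl

theorem gen_congr {F G : M n l → ℝ} {p : M n l} (h : F =ᶠ[𝓝 p] G) (i : Fin n) :
    gen R i F p = gen R i G p := by
  rw [gen, gen, h.fderiv_eq]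

end Smoothness

section Necessity

variable [NeZero l] {U : Set (FullJet n l)} {𝓗 : FullJet n l → ℝ} {P : M n l}

/-- Leibniz' rule for H = (H/Λ)Λ. -/
theorem Cond2On.cond1On {H : M n l → ℝ} {V : Set (M n l)} (hV : IsOpen V)
    (hH : ContDiffOn ℝ ∞ H V) (h : Cond2On H V) : Cond1On H V := by
  obtain ⟨R, Lam, hR, hLam, hne, hquot, hcomm⟩ := h
  refine ⟨R, fun i p => gen R i Lam p / Lam p, hR,
    fun i => (contDiffOn_gen hV hR hLam i).div hLam hne, fun i p hp => ?_, hcomm⟩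
  have hLd : DifferentiableAt ℝ Lam p := (hLam.contDiffAt (hV.mem_nhds hp)).differentiableAt (by simp)
  have hQd : DifferentiableAt ℝ (fun p => H p / Lam p) p :=
    ((hH.div hLam hne).contDiffAt (hV.mem_nhds hp)).differentiableAt (by simp)
  have hev : H =ᶠ[𝓝 p] fun p => (H p / Lam p) * Lam p := by
    filter_upwards [hV.mem_nhds hp] with p' hp'
    rw [div_mul_cancel₀ _ (hne p' hp')]
  rw [gen_congr hev, gen_mul hQd hLd, hquot i p hp]
  ring

/-- In the coordinates (q, c) given by the jet map, D_i is ∂/∂q^i. It annihilates the last parameter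
κ, and R_j, which depends on q only through q^j. Dividing H by κ produces Λ. -/
theorem HasExtendedSolutionAt.locallyAt_cond2On (hU : IsOpen U) (h𝓗 : ContDiffOn ℝ ∞ 𝓗 U)
    (hreg : fderiv ℝ (reduced 𝓗) P ≠ 0) (h : HasExtendedSolutionAt U 𝓗 P) :
    LocallyAt U P (Cond2On (reduced 𝓗)) := by
  obtain ⟨I, C, u, hu, q₀, hq₀, c₀, hc₀, hlast, hP⟩ := h
  obtain ⟨S, hS, huS⟩ := hu.separated.exists_uncurried
  obtain ⟨hI, hC, -⟩ := hu.separated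
  have hinj := (rank_paramMatrix_iff_injective hI hC hS huS hq₀ hc₀).1 (hu.complete q₀ hq₀ _ hc₀)
  rw [jet_eq_fibreJet l hI hC hS huS hq₀ hc₀] at hP
  have hB := (isOpen_box hI).prod hC
  set Φ : (Fin n → ℝ) × (Fin (n * l + 1) → ℝ) → M n l := fun x => (x.1, fibreJet l S x)
  have hfib := contDiffOn_fibreJet l hI hC hS
  have hΦ : ContDiffOn ℝ ∞ Φ (univ.pi I ×ˢ C) := contDiffOn_fst.prodMk hfib
  have hdΦ : ∀ x ∈ univ.pi I ×ˢ C, HasFDerivAt Φ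
      ((ContinuousLinearMap.fst ℝ _ _).prod (fderiv ℝ (fibreJet l S) x)) x := fun x hx =>
    hasFDerivAt_fst.prodMk
      ((hfib.contDiffAt (hB.mem_nhds hx)).differentiableAt (by simp)).hasFDerivAt
  have hs : IsOpen ((univ.pi I ×ˢ C) ∩ Φ ⁻¹' (incl ⁻¹' U)) :=
    hΦ.continuousOn.isOpen_inter_preimage hB (isOpen_incl_preimage hU)
  have hx₀ : (q₀, c₀) ∈ (univ.pi I ×ˢ C) ∩ Φ ⁻¹' (incl ⁻¹' U) := by
    refine ⟨⟨hq₀, hc₀⟩, ?_⟩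
    have := (hu.solution q₀ hq₀ c₀ hc₀ hlast).1
    rwa [fullJet_eq_incl_jet hI (separatedOn_slice hS huS hc₀) hq₀,
      jet_eq_fibreJet l hI hC hS huS hq₀ hc₀] at this
  set A := (ContinuousLinearMap.fst ℝ (Fin n → ℝ) (Fin (n * l + 1) → ℝ)).prod
    (fderiv ℝ (fibreJet l S) (q₀, c₀))
  have hAinj : Function.Injective A := by
    rw [injective_iff_map_eq_zero]
    rintro ⟨dq, dc⟩ hd
    obtain rfl : dq = 0 := congrArg Prod.fst hd
    have h2 : paramDeriv l S (q₀, c₀) dc = 0 := congrArg Prod.snd hd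
    rw [hinj (h2.trans (map_zero (paramDeriv l S (q₀, c₀))).symm)]
    rfl
  let A' : ((Fin n → ℝ) × (Fin (n * l + 1) → ℝ)) ≃L[ℝ] M n l :=
    (LinearMap.linearEquivOfInjective
      (A : ((Fin n → ℝ) × (Fin (n * l + 1) → ℝ)) →ₗ[ℝ] M n l) hAinj (by
        simp [Module.finrank_prod, Module.finrank_pi_fintype, add_comm])).toContinuousLinearEquiv
  have hA' : HasFDerivAt Φ (A' : _ →L[ℝ] M n l) (q₀, c₀) :=
    (hdΦ _ hx₀.1).congr_fderiv (by ext x <;> rfl)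
  obtain ⟨e, hex, hes, he, hinv⟩ := exists_openPartialHomeomorph hs (hΦ.mono inter_subset_left)
    hx₀ hA'
  have hmem : ∀ p ∈ e.target, e.symm p ∈ univ.pi I ×ˢ C := fun p hp => (hes (e.map_target hp)).1
  have hright : ∀ p ∈ e.target, Φ (e.symm p) = p := fun p hp => by rw [← he, e.right_inv hp]
  have hPt : P ∈ e.target := by 
    have := e.map_source hex
    rw [he] at this
    rwa [← hP]
  have hPs : e.symm P = (q₀, c₀) := by
    rw [← hP]
    exact (congrArg e.symm (he (q₀, c₀)).symm).trans (e.left_inv hex)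
  set R : Fin n → M n l → ℝ := fun j p =>
    tderiv^[l + 1] (S j) ((e.symm p).1 j, (e.symm p).2)
  set κ : M n l → ℝ := fun p => (e.symm p).2 (Fin.last _)
  have hR : ∀ j, ContDiffOn ℝ ∞ (R j) e.target := fun j =>
    (contDiffOn_tderiv_iterate_box hI hC hS j (l + 1)).comp hinv hmem
  have hκ : ContDiffOn ℝ ∞ κ e.target := contDiffOn_pi.1 hinv.snd _
  have hgenVec : ∀ p ∈ e.target, ∀ i, genVec R i p =
      (ContinuousLinearMap.fst ℝ _ _).prod (fderiv ℝ (fibreJet l S) (e.symm p))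
        (Pi.single i 1, 0) := by
    intro p hp i
    rw [prod_fderiv_fibreJet_single hI hC hS (hmem p hp)]
    exact congrArg (genVec (fun _ _ => R i p) i) (hright p hp).symm
  have hchain : ∀ (F : M n l → ℝ), ∀ p ∈ e.target, DifferentiableAt ℝ F p → ∀ i,
      gen R i F p = fderiv ℝ (fun x => F (Φ x)) (e.symm p) (Pi.single i 1, 0) := by
    intro F p hp hF i
    have hd := hdΦ (e.symm p) (hmem p hp)
    rw [← hright p hp] at hF
    have h1 := (hF.hasFDerivAt.comp _ hd).fderiv
    simp only [Function.comp_def] at h1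
    rw [h1, ContinuousLinearMap.comp_apply, ← hgenVec p hp i, hright p hp]
    rfl
  have hleft : ∀ p ∈ e.target, ∀ᶠ x in 𝓝 (e.symm p), e.symm (Φ x) = x := fun p hp => by
    filter_upwards [e.open_source.mem_nhds (e.map_target hp)] with x hx
    rw [← he, e.left_inv hx]
  have hdiff : ∀ {F : M n l → ℝ}, ContDiffOn ℝ ∞ F e.target → ∀ p ∈ e.target,
      DifferentiableAt ℝ F p := fun hF p hp =>
    (hF.contDiffAt (e.open_target.mem_nhds hp)).differentiableAt (by simp)
  have hgenκ : ∀ i, ∀ p ∈ e.target, gen R i κ p = 0 := by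
    intro i p hp
    rw [hchain κ p hp (hdiff hκ p hp)]
    have hev : (fun x => κ (Φ x)) =ᶠ[𝓝 (e.symm p)] fun x =>
        ((lastL _).comp (ContinuousLinearMap.snd ℝ (Fin n → ℝ) (Fin (n * l + 1) → ℝ))) x := by
      filter_upwards [hleft p hp] with x hx
      simp [κ, hx]
    rw [hev.fderiv_eq, ContinuousLinearMap.fderiv]
    simp
  have hcomm : ∀ i j, j ≠ i → ∀ p ∈ e.target, gen R i (R j) p = 0 := by
    intro i j hj p hp
    rw [hchain (R j) p hp (hdiff (hR j) p hp)]
    have hev : (fun x => R j (Φ x)) =ᶠ[𝓝 (e.symm p)] fun x =>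
        tderiv^[l + 1] (S j) (x.1 j, x.2) := by
      filter_upwards [hleft p hp] with x hx
      simp only [R, hx]
    rw [hev.fderiv_eq, fderiv_tderiv_iterate_box_single hI hC hS (hmem p hp), if_neg hj]
  have htU : e.target ⊆ incl ⁻¹' U := fun p hp => by
    have := (hes (e.map_target hp)).2
    rwa [mem_preimage, hright p hp] at this
  have hH : ContDiffOn ℝ ∞ (reduced 𝓗) e.target := (contDiffOn_reduced h𝓗).mono htU
  have hz : ∀ p ∈ e.target, κ p = 0 → reduced 𝓗 p = 0 := by
    intro p hp h0
    obtain ⟨hq, hc⟩ := hmem p hp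
    have h1 := (hu.solution _ hq _ hc h0).2
    rw [fullJet_eq_incl_jet hI (separatedOn_slice hS huS hc) hq,
      jet_eq_fibreJet l hI hC hS huS hq hc] at h1
    have h2 := hright p hp
    rw [← h2]
    exact h1
  have hκP : κ P = 0 := by simp only [κ, hPs, hlast]
  have hκreg : fderiv ℝ κ P ≠ 0 := by
    intro h0
    have hd := hdΦ (e.symm P) (hmem P hPt)
    have hκd := hdiff hκ P hPt
    rw [← hright P hPt] at hκd h0
    have h1 := hκd.hasFDerivAt.comp _ hd
    rw [h0, ContinuousLinearMap.zero_comp] at h1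
    have h2 : HasFDerivAt (κ ∘ Φ)
        ((lastL _).comp (ContinuousLinearMap.snd ℝ (Fin n → ℝ) (Fin (n * l + 1) → ℝ)))
        (e.symm P) := by
      refine (ContinuousLinearMap.hasFDerivAt _).congr_of_eventuallyEq ?_
      filter_upwards [hleft P hPt] with x hx
      simp [κ, hx]
    have h3 := DFunLike.congr_fun (h1.unique h2) (0, Pi.single (Fin.last _) 1)
    simp at h3
  obtain ⟨W, lam, hW, hPW, hWt, hlam, hHlam⟩ := exists_smooth_quotient e.open_target hκ hH hPt
    hκP hκreg hz
  -- As κ(P) = 0, dH(P) = lam(P) dκ(P).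
  have hlamP : lam P ≠ 0 := by
    intro h0
    apply hreg
    have hev : reduced 𝓗 =ᶠ[𝓝 P] fun p => lam p * κ p := by
      filter_upwards [hW.mem_nhds hPW] with p hp using hHlam p hp
    rw [hev.fderiv_eq, fderiv_fun_mul
      ((hlam.contDiffAt (hW.mem_nhds hPW)).differentiableAt (by simp)) (hdiff hκ P hPt), h0, hκP]
    simp
  refine ⟨W ∩ lam ⁻¹' {0}ᶜ, hlam.continuousOn.isOpen_inter_preimage hW isOpen_compl_singleton,
    ⟨hPW, hlamP⟩, fun p hp => htU (hWt hp.1), R, lam,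
    fun i => (hR i).mono fun p hp => hWt hp.1, hlam.mono inter_subset_left, fun p hp => hp.2,
    fun i p hp => ?_, fun i j hj p hp => hcomm i j hj p (hWt hp.1)⟩
  rw [← hgenκ i p (hWt hp.1)]
  refine gen_congr ?_ i
  filter_upwards [(hlam.continuousOn.isOpen_inter_preimage hW isOpen_compl_singleton).mem_nhds
    hp] with p' hp'
  have hne : lam p' ≠ 0 := hp'.2
  rw [hHlam p' hp'.1]
  field_simp

/-- With R_i' = R_i − λ_i H / (∂H/∂u_i^{(l)}) the new D_i annihilates H. On H = 0 nothing changes in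
D_i, and D_i R_j' = D_i R_j there because D_i H = λ_i H vanishes as well. -/
theorem LocallyAt.cond3On_of_cond1On (h𝓗 : ContDiffOn ℝ ∞ 𝓗 U)
    (htop : ∀ i, topDeriv i (reduced 𝓗) P ≠ 0) (h : LocallyAt U P (Cond1On (reduced 𝓗))) :
    LocallyAt U P (Cond3On (reduced 𝓗)) := by
  obtain ⟨V, hV, hPV, hVU, R, lam, hR, hlam, hHlam, hcomm⟩ := h
  set H : M n l → ℝ := reduced 𝓗
  have hH : ContDiffOn ℝ ∞ H V := (contDiffOn_reduced h𝓗).mono hVU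
  have ht : ∀ i, ContDiffOn ℝ ∞ (topDeriv i H) V := contDiffOn_topDeriv hV hH
  obtain ⟨W, hWsub, hW, hPW⟩ : ∃ W, (∀ p ∈ W, p ∈ V ∧ ∀ i, topDeriv i H p ≠ 0) ∧
      IsOpen W ∧ P ∈ W := by
    have hmem : ∀ᶠ p in 𝓝 P, p ∈ V := hV.mem_nhds hPV
    refine _root_.eventually_nhds_iff.1 (hmem.and (eventually_all.2 fun i => ?_))
    exact ((ht i).continuousOn.continuousAt (hV.mem_nhds hPV)).eventually_ne (htop i)
  set μ : Fin n → M n l → ℝ := fun i p => -(lam i p / topDeriv i H p)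
  set R' : Fin n → M n l → ℝ := fun i p => R i p + μ i p * H p
  have hμ : ∀ i, ContDiffOn ℝ ∞ (μ i) W := fun i =>
    (((hlam i).mono fun p hp => (hWsub p hp).1).div ((ht i).mono fun p hp => (hWsub p hp).1)
      fun p hp => (hWsub p hp).2 i).neg
  have hHW : ContDiffOn ℝ ∞ H W := hH.mono fun p hp => (hWsub p hp).1
  have hRW : ∀ i, ContDiffOn ℝ ∞ (R i) W := fun i => (hR i).mono fun p hp => (hWsub p hp).1
  have hd : ∀ {F : M n l → ℝ}, ContDiffOn ℝ ∞ F W → ∀ p ∈ W, DifferentiableAt ℝ F p :=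
    fun hF p hp => (hF.contDiffAt (hW.mem_nhds hp)).differentiableAt (by simp)
  refine ⟨W, hW, hPW, fun p hp => hVU (hWsub p hp).1, R', fun i => (hRW i).add ((hμ i).mul hHW),
    fun i p hp => ?_, fun i j hj p hp h0 => ?_⟩
  · have hne := (hWsub p hp).2 i
    rw [gen_eq_add_topDeriv R, hHlam i p (hWsub p hp).1]
    simp only [R', μ]
    field_simp
    ring
  · have h1 : R' i p - R i p = 0 := by simp [R', h0]
    rw [gen_eq_add_topDeriv R, h1, zero_mul, add_zero]
    have h2 : gen R i (R' j) p = gen R i (R j) p + gen R i (fun p => μ j p * H p) p := by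
      have : fderiv ℝ (R' j) p = fderiv ℝ (R j) p + fderiv ℝ (fun p => μ j p * H p) p :=
        fderiv_fun_add (hd (hRW j) p hp) (hd ((hμ j).mul hHW) p hp)
      simp only [gen, this]
      rfl
    rw [h2, hcomm i j hj p (hWsub p hp).1, gen_mul (hd (hμ j) p hp) (hd hHW p hp),
      hHlam i p (hWsub p hp).1, h0]
    ring

end Necessity

end Conditions

/-! ### Adapted parameters of a fibre -/

section Charts

variable {n l : ℕ}

section FibreChart

theorem exists_equiv_last {Y : Type*} [NormedAddCommGroup Y] [NormedSpace ℝ Y]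
    [FiniteDimensional ℝ Y] {m : ℕ} (hdim : Module.finrank ℝ Y = m + 1) {ℓ : Y →L[ℝ] ℝ}
    (hℓ : ℓ ≠ 0) :
    ∃ L : Y ≃L[ℝ] (Fin (m + 1) → ℝ), ∀ y, L y (Fin.last m) = ℓ y := by
  obtain ⟨v, hv⟩ : ∃ v, ℓ v = 1 := by
    obtain ⟨w, hw⟩ := DFunLike.ne_iff.1 hℓ
    refine ⟨(ℓ w)⁻¹ • w, ?_⟩
    rw [map_smul, smul_eq_mul, inv_mul_cancel₀ hw]
  let ℓ' : Module.Dual ℝ Y := (ℓ : Y →ₗ[ℝ] ℝ)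
  have hℓ' : ℓ' ≠ 0 := fun h => hℓ (ContinuousLinearMap.coe_injective h)
  have hker : Module.finrank ℝ (LinearMap.ker ℓ') = m := by
    have := Module.Dual.finrank_ker_add_one_of_ne_zero hℓ'
    omega
  let φ : LinearMap.ker ℓ' ≃ₗ[ℝ] (Fin m → ℝ) :=
    LinearEquiv.ofFinrankEq _ _ (by rw [hker, Module.finrank_fin_fun])
  let π : Y →ₗ[ℝ] LinearMap.ker ℓ' :=
    (LinearMap.id - ℓ'.smulRight v).codRestrict _ fun y => by
      change ℓ (y - ℓ y • v) = 0
      simp [hv]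
  let T : Y →ₗ[ℝ] (Fin (m + 1) → ℝ) := LinearMap.pi fun j =>
    Fin.lastCases ℓ' (fun i => (LinearMap.proj i).comp (φ.toLinearMap.comp π)) j
  have hlast : ∀ y, T y (Fin.last m) = ℓ y := fun y => by simp [T, ℓ']
  have hT : Function.Injective T := by
    rw [injective_iff_map_eq_zero]
    intro y hy
    have h1 : ℓ y = 0 := by rw [← hlast, hy]; rfl
    have h2 : φ (π y) = 0 := by
      ext i
      have := congrFun hy i.castSucc
      simpa [T] using this
    have h3 : (π y : Y) = 0 := by rw [(map_eq_zero_iff φ φ.injective).1 h2]; rfl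
    change y - ℓ y • v = 0 at h3
    simpa [h1] using h3
  exact ⟨(LinearMap.linearEquivOfInjective T hT
    (by rw [hdim, Module.finrank_fin_fun])).toContinuousLinearEquiv, hlast⟩

/-- Around a regular zero of `h` there are coordinates, the last of which is `h`. -/
theorem exists_parametrization {Y : Type*} [NormedAddCommGroup Y] [NormedSpace ℝ Y]
    [FiniteDimensional ℝ Y] {m : ℕ} (hdim : Module.finrank ℝ Y = m + 1) {h : Y → ℝ} {V : Set Y}
    (hV : IsOpen V) (hh : ContDiffOn ℝ ∞ h V) {y : Y} (hy : y ∈ V) (h0 : h y = 0)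
    (hreg : fderiv ℝ h y ≠ 0) :
    ∃ (C : Set (Fin (m + 1) → ℝ)) (g : (Fin (m + 1) → ℝ) → Y), IsOpen C ∧ 0 ∈ C ∧
      ContDiffOn ℝ ∞ g C ∧ g 0 = y ∧ (∀ c ∈ C, h (g c) = c (Fin.last m)) ∧
      Function.Injective (fderiv ℝ g 0) := by
  have : CompleteSpace Y := FiniteDimensional.complete ℝ Y
  obtain ⟨e, hye, heV, he0, hes, hinv, heh⟩ := exists_straightening hV hh hy h0 hreg
  obtain ⟨L, hL⟩ := exists_equiv_last hdim hreg
  have h0t : (0 : Y) ∈ e.target := he0 ▸ e.map_source hye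
  have hC : IsOpen (L.symm ⁻¹' e.target) := e.open_target.preimage L.symm.continuous
  have h0C : (0 : Fin (m + 1) → ℝ) ∈ L.symm ⁻¹' e.target := by simpa using h0t
  have hg : ContDiffOn ℝ ∞ (fun c => e.symm (L.symm c)) (L.symm ⁻¹' e.target) :=
    hinv.comp L.symm.contDiff.contDiffOn fun c hc => hc
  have hgy : e.symm (L.symm 0) = y := by rw [map_zero, ← he0, e.left_inv hye]
  refine ⟨L.symm ⁻¹' e.target, fun c => e.symm (L.symm c), hC, h0C, hg, hgy, fun c hc => ?_, ?_⟩
  · rw [← heh _ (e.map_target hc), e.right_inv hc, ← hL, L.apply_symm_apply]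
  · have hgd := ((hg.contDiffAt (hC.mem_nhds h0C)).differentiableAt (by simp)).hasFDerivAt
    have hed : DifferentiableAt ℝ e y :=
      (hes.contDiffAt (e.open_source.mem_nhds hye)).differentiableAt (by simp)
    rw [← hgy] at hed
    have hcomp := (L : Y →L[ℝ] Fin (m + 1) → ℝ).hasFDerivAt.comp _ 
      (HasFDerivAt.comp (g := e) (f := fun c => e.symm (L.symm c)) 0 hed.hasFDerivAt hgd)
    have hid : HasFDerivAt (fun c : Fin (m + 1) → ℝ => c) (ContinuousLinearMap.id ℝ _) 0 :=
      hasFDerivAt_id _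
    have heq := hcomp.congr_of_eventuallyEq (f₁ := fun c => c) (by
      filter_upwards [hC.mem_nhds h0C] with c hc
      simp only [Function.comp_apply]
      rw [e.right_inv hc]
      simp)
    have huniq := hid.unique heq
    -- By the chain rule, the derivative of the chart is a left inverse of that of `g`.
    refine Function.Injective.of_comp (f := fun x => L (fderiv ℝ e (e.symm (L.symm 0)) x)) ?_
    intro a b hab
    have ha := DFunLike.congr_fun huniq a
    have hb := DFunLike.congr_fun huniq b
    exact ha.trans (Eq.trans hab hb.symm)

end FibreChart

/-! ### Uniqueness for a Goursat problem -/

section MeanValue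

/-- Mean value inequality along the segment. Partial derivatives are needed only in the directions
where the endpoints differ. -/
theorem abs_sub_le_of_abs_pderiv_le {f : (Fin n → ℝ) → ℝ} {q₀ : Fin n → ℝ} {δ A : ℝ}
    (hA : 0 ≤ A) (hf : ∀ x ∈ ball q₀ δ, DifferentiableAt ℝ f x) {q q' : Fin n → ℝ}
    (hq : q ∈ ball q₀ δ) (hq' : q' ∈ ball q₀ δ)
    (hb : ∀ i, q' i = q i ∨ ∀ x ∈ ball q₀ δ, |pderiv i f x| ≤ A) :
    |f q' - f q| ≤ n * (A * (2 * δ)) := by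
  have hline : ∀ s ∈ Icc (0 : ℝ) 1, q + s • (q' - q) ∈ ball q₀ δ := fun s hs =>
    (convex_ball q₀ δ).add_smul_sub_mem hq hq' hs
  have hder : ∀ s ∈ Icc (0 : ℝ) 1, HasDerivAt (fun s : ℝ => f (q + s • (q' - q)))
      (fderiv ℝ f (q + s • (q' - q)) (q' - q)) s := fun s hs => by
    have h1 : HasDerivAt (fun s : ℝ => q + s • (q' - q)) (q' - q) s := by
      simpa using ((hasDerivAt_id s).smul_const (q' - q)).const_add q
    exact (hf _ (hline s hs)).hasFDerivAt.comp_hasDerivAt s h1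
  have key := norm_image_sub_le_of_norm_deriv_le_segment_01'
    (f := fun s : ℝ => f (q + s • (q' - q))) (C := n * (A * (2 * δ)))
    (fun s hs => (hder s hs).hasDerivWithinAt) (fun s hs => ?_)
  · simpa using key
  · rw [clm_apply_eq_sum]
    refine (norm_sum_le _ _).trans ?_
    have hdist : ∀ i, |q' i - q i| ≤ 2 * δ := fun i => by
      have h1 : dist q' q < δ + δ := (dist_triangle_right _ _ q₀).trans_lt (add_lt_add hq' hq)
      have h2 := (dist_le_pi_dist q' q i).trans h1.le
      rw [Real.dist_eq] at h2
      linarith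
    have hterm : ∀ i ∈ Finset.univ, ‖fderiv ℝ f (q + s • (q' - q)) (Pi.single i 1) * (q' - q) i‖ ≤
        A * (2 * δ) := fun i _ => by
      rw [Real.norm_eq_abs, abs_mul, Pi.sub_apply]
      rcases hb i with h | h
      · rw [h, sub_self, abs_zero, mul_zero]
        exact mul_nonneg hA ((abs_nonneg _).trans (hdist i))
      · exact mul_le_mul (h _ (hline s ⟨hs.1, hs.2.le⟩)) (hdist i) (abs_nonneg _) hA
    refine (Finset.sum_le_sum hterm).trans ?_
    simp

/-- Uniqueness for a Goursat problem on a small box: the errors `h` and `ρⱼ - ψⱼ` vanish. -/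
theorem eq_zero_of_goursat {q₀ : Fin n → ℝ} {δ K b₀ : ℝ} (hδ : 0 < δ) (hK : 0 ≤ K)
    (hsmall : n * (K * (2 * δ)) ≤ 1 / 2) {h : (Fin n → ℝ) → ℝ} {ψ : Fin n → (Fin n → ℝ) → ℝ}
    {ρ : Fin n → ℝ → ℝ} (hhd : ∀ q ∈ ball q₀ δ, DifferentiableAt ℝ h q)
    (hψd : ∀ j, ∀ q ∈ ball q₀ δ, DifferentiableAt ℝ (ψ j) q) (h0 : h q₀ = 0)
    (haxis : ∀ j, ∀ q ∈ ball q₀ δ, ρ j (q j) = ψ j (Function.update q₀ j (q j)))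
    (hhb : ∀ q ∈ ball q₀ δ, |h q| ≤ b₀) (hψb : ∀ j, ∀ q ∈ ball q₀ δ, |ψ j q| ≤ b₀)
    (hhK : ∀ q ∈ ball q₀ δ, ∀ b, |h q| ≤ b → (∀ j, |ρ j (q j) - ψ j q| ≤ b) →
      ∀ i, |pderiv i h q| ≤ K * b)
    (hψK : ∀ q ∈ ball q₀ δ, ∀ b, |h q| ≤ b → (∀ j, |ρ j (q j) - ψ j q| ≤ b) →
      ∀ i j, j ≠ i → |pderiv i (ψ j) q| ≤ K * b) :
    ∀ q ∈ ball q₀ δ, h q = 0 := by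
  have hup : ∀ j, ∀ q ∈ ball q₀ δ, Function.update q₀ j (q j) ∈ ball q₀ δ := fun j q hq => by
    rw [mem_ball, dist_pi_lt_iff hδ] at hq ⊢
    intro i
    rcases eq_or_ne i j with rfl | hi
    · simpa using hq i
    · simpa [hi] using hδ
  have hb₀ : 0 ≤ b₀ := (abs_nonneg _).trans (hhb q₀ (mem_ball_self hδ))
  -- The factor 2 covers the difference of two values of ψ_j at the start; `hsmall` halves the bound
  -- at each step.
  have hiter : ∀ k : ℕ, ∀ q ∈ ball q₀ δ, |h q| ≤ 2 * b₀ * (1 / 2) ^ k ∧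
      ∀ j, |ρ j (q j) - ψ j q| ≤ 2 * b₀ * (1 / 2) ^ k := by
    intro k
    induction k with
    | zero =>
      intro q hq
      refine ⟨by linarith [hhb q hq], fun j => ?_⟩
      rw [haxis j q hq]
      have := abs_sub (ψ j (Function.update q₀ j (q j))) (ψ j q)
      linarith [hψb j q hq, hψb j _ (hup j q hq)]
    | succ k ih =>
      intro q hq
      set b := 2 * b₀ * (1 / 2 : ℝ) ^ k with hbdef
      have hb : 0 ≤ b := by positivity
      have hKb : 0 ≤ K * b := mul_nonneg hK hb
      have hle : n * (K * b * (2 * δ)) ≤ 2 * b₀ * (1 / 2) ^ (k + 1) := by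
        have := mul_le_mul_of_nonneg_right hsmall hb
        have heq : 2 * b₀ * (1 / 2 : ℝ) ^ (k + 1) = 1 / 2 * b := by rw [hbdef]; ring
        rw [heq]
        linarith
      constructor
      · have := abs_sub_le_of_abs_pderiv_le hKb hhd (mem_ball_self hδ) hq fun i =>
          Or.inr fun x hx => hhK x hx b (ih x hx).1 (ih x hx).2 i
        rw [h0, sub_zero] at this
        exact this.trans hle
      · intro j
        -- From q to its projection on the j-th axis the coordinate q^j is constant, so ∂_j ψ_j, for
        -- which no bound is available, does not enter.
        have := abs_sub_le_of_abs_pderiv_le hKb (hψd j) hq (hup j q hq) fun i => by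
          rcases eq_or_ne j i with rfl | hj
          · exact Or.inl (by simp)
          · exact Or.inr fun x hx => hψK x hx b (ih x hx).1 (ih x hx).2 i j hj
        rw [haxis j q hq]
        exact this.trans hle
  intro q hq
  have hlim : Tendsto (fun k : ℕ => 2 * b₀ * (1 / 2 : ℝ) ^ k) atTop (𝓝 (2 * b₀ * 0)) :=
    (tendsto_pow_atTop_nhds_zero_of_lt_one (by norm_num) (by norm_num)).const_mul _
  rw [mul_zero] at hlim
  exact abs_nonpos_iff.1 (ge_of_tendsto' hlim fun k => (hiter k q hq).1)

end MeanValue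

end Charts

/-! ### Construction of a separated family from the flows of the D_i -/

section Sufficient

theorem eventually_abs_le {X : Type*} [TopologicalSpace X] {V : Set X} {P : X} {F : X → ℝ} (hV : IsOpen V) (hP : P ∈ V) (hF : ContinuousOn F V) :
    ∀ᶠ p in 𝓝 P, |F p| ≤ |F P| + 1 :=
  ((hF.continuousAt (hV.mem_nhds hP)).abs.eventually_lt_const (lt_add_one _)).mono
    fun _ hp => hp.le

variable {n l : ℕ} [NeZero l]

section FlowFamily

variable {R : Fin n → M n l → ℝ} {V : Set (M n l)} {P : M n l}

theorem eq_of_hasDerivAt_zero {f : ℝ → ℝ} {r : ℝ} (hr : 0 < r)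
    (hf : ∀ t ∈ ball (0 : ℝ) r, HasDerivAt f 0 t) {t : ℝ} (ht : t ∈ ball (0 : ℝ) r) :
    f t = f 0 :=
  isOpen_ball.is_const_of_deriv_eq_zero (convex_ball (0 : ℝ) r).isPreconnected
    (fun s hs => (hf s hs).differentiableAt.differentiableWithinAt) (fun s hs => (hf s hs).deriv)
    ht (mem_ball_self hr)

/-- Local flows of the vector fields `Dᵢ`. -/
theorem exists_flow_genVec [NeZero n] (hV : IsOpen V) (hR : ∀ i, ContDiffOn ℝ ∞ (R i) V)
    (hP : P ∈ V) :
    ∃ r > 0, ∃ φ : Fin n → ℝ × M n l → M n l,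
      (∀ i, ContDiffOn ℝ ∞ (φ i) (ball 0 r ×ˢ ball P r)) ∧
      ∀ i, ∀ x ∈ ball P r, φ i (0, x) = x ∧ ∀ t ∈ ball (0 : ℝ) r, φ i (t, x) ∈ V ∧
        HasDerivAt (fun s => φ i (s, x)) (genVec R i (φ i (t, x))) t ∧
        (∀ j, (φ i (t, x)).1 j = x.1 j + if j = i then t else 0) ∧
        ∀ j, j ≠ i → (φ i (t, x)).2.2 j = x.2.2 j := by
  choose r hr φ hφ h using fun i => exists_flow hV (contDiffOn_genVec hR i) hP
  set ρ := Finset.univ.inf' ⟨(0 : Fin n), Finset.mem_univ _⟩ r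
  have hρ : 0 < ρ := (Finset.lt_inf'_iff _).2 fun i _ => hr i
  have hle : ∀ i, ρ ≤ r i := fun i => Finset.inf'_le _ (Finset.mem_univ i)
  refine ⟨ρ, hρ, φ, fun i => (hφ i).mono (prod_mono (ball_subset_ball (hle i))
    (ball_subset_ball (hle i))), fun i x hx => ?_⟩
  obtain ⟨h0, hflow⟩ := h i x (ball_subset_ball (hle i) hx)
  have hd : ∀ t ∈ ball (0 : ℝ) ρ, HasDerivAt (fun s => φ i (s, x)) (genVec R i (φ i (t, x))) t :=
    fun t ht => (hflow t (ball_subset_ball (hle i) ht)).2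
  refine ⟨h0, fun t ht => ⟨(hflow t (ball_subset_ball (hle i) ht)).1, hd t ht, fun j => ?_,
    fun j hj => funext fun k => ?_⟩⟩
  · have h1 := eq_of_hasDerivAt_zero hρ (f := fun t => (φ i (t, x)).1 j - if j = i then t else 0)
      (fun t ht => by
        have h2 : HasDerivAt (fun s => (φ i (s, x)).1 j) ((Pi.single i 1 : Fin n → ℝ) j) t :=
          hasDerivAt_pi.1 (hasFDerivAt_fst.comp_hasDerivAt t (hd t ht)) j
        rcases eq_or_ne j i with rfl | hj
        · rw [Pi.single_eq_same] at h2
          simpa using h2.fun_sub (hasDerivAt_id' t)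
        · rw [Pi.single_eq_of_ne hj] at h2
          simpa [hj] using h2) ht
    simp only [h0, ite_self, sub_zero] at h1
    linarith
  · have h1 := eq_of_hasDerivAt_zero hρ (f := fun t => (φ i (t, x)).2.2 j k)
      (fun t ht => by
        have h2 := hasDerivAt_pi.1 (hasDerivAt_pi.1 (hasFDerivAt_snd.comp_hasDerivAt t
          (hasFDerivAt_snd.comp_hasDerivAt t (hd t ht))) j) k
        simpa [genVec, Pi.single_eq_of_ne hj] using h2) ht
    simpa only [h0] using h1

/-- Reads the iterated derivatives of S_i off the chain of equations u' = u_i, …, (u_i^{(l)})' = R_i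
along an integral curve. -/
theorem tderiv_iterate_eqOn {E : Type*} [NormedAddCommGroup E] [NormedSpace ℝ E]
    {W : Set (ℝ × E)} (hW : IsOpen W) {a : ℕ → ℝ × E → ℝ} (ha : ContDiffOn ℝ ∞ (a 0) W) {N : ℕ}
    (hd : ∀ k < N, ∀ x ∈ W, HasDerivAt (fun s => a k (s, x.2)) (a (k + 1) x) x.1) :
    ∀ k ≤ N, EqOn (tderiv^[k] (a 0)) (a k) W := by
  intro k
  induction k with
  | zero => exact fun _ _ _ => rfl
  | succ k ih =>
    intro hk x hx
    have hx' : (x.1, x.2) ∈ W := hx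
    rw [Function.iterate_succ_apply']
    have h1 : HasDerivAt (fun s => tderiv^[k] (a 0) (s, x.2)) (tderiv (tderiv^[k] (a 0)) x) x.1 :=
      hasDerivAt_tderiv (((contDiffOn_tderiv_iterate hW ha k).contDiffAt
        (hW.mem_nhds hx')).differentiableAt (by simp))
    refine h1.unique ((hd k hk x hx).congr_of_eventuallyEq ?_)
    have hc : ContinuousAt (fun s : ℝ => (s, x.2)) x.1 := by fun_prop
    filter_upwards [hc.preimage_mem_nhds (hW.mem_nhds hx')] with s hs
    exact ih (Nat.le_of_succ_le hk) hs

/-- The family `∑ᵢ Sᵢ` whose jets on the coordinate axes through `P` are integral curves of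
the `Dᵢ`, and whose initial values are `g`. -/
theorem exists_separated_family [NeZero n] (hV : IsOpen V) (hR : ∀ i, ContDiffOn ℝ ∞ (R i) V)
    (hP : P ∈ V) {E : Type*} [NormedAddCommGroup E] [NormedSpace ℝ E] {C : Set E} (hC : IsOpen C)
    {g : E → ℝ × (Fin n → Fin l → ℝ)} (hg : ContDiffOn ℝ ∞ g C) {c₀ : E} (hc₀ : c₀ ∈ C)
    (hgc : g c₀ = P.2) :
    ∃ r > 0, ∃ C' ⊆ C, IsOpen C' ∧ c₀ ∈ C' ∧ ∃ S : Fin n → ℝ × E → ℝ,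
      (∀ i, ContDiffOn ℝ ∞ (S i) (ball (P.1 i) r ×ˢ C')) ∧
      (∀ c ∈ C', fibreJet l S (P.1, c) = g c) ∧
      ∀ q ∈ univ.pi fun i => ball (P.1 i) r, ∀ c ∈ C', ∀ j,
        tderiv^[l + 1] (S j) (q j, c) = R j (Function.update P.1 j (q j),
          fibreJet l S (Function.update P.1 j (q j), c)) := by
  obtain ⟨r, hr, φ, hφ, h⟩ := exists_flow_genVec hV hR hP
  set base : E → M n l := fun c => (P.1, g c)
  have hbase : ContDiffOn ℝ ∞ base C := contDiffOn_const.prodMk hg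
  set C' := C ∩ base ⁻¹' ball P r
  have hC' : IsOpen C' := hbase.continuousOn.isOpen_inter_preimage hC isOpen_ball
  have hc₀' : c₀ ∈ C' := ⟨hc₀, by
    have : base c₀ = P := Prod.ext rfl hgc
    rw [mem_preimage, this]
    exact mem_ball_self hr⟩
  set Γ : Fin n → ℝ × E → M n l := fun i x => φ i (x.1 - P.1 i, base x.2)
  have hshift : ∀ i, ∀ x ∈ ball (P.1 i) r ×ˢ C', x.1 - P.1 i ∈ ball (0 : ℝ) r := fun i x hx => by
    have := hx.1
    rw [mem_ball, dist_eq_norm] at this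
    rwa [mem_ball_zero_iff]
  have hΓ : ∀ i, ContDiffOn ℝ ∞ (Γ i) (ball (P.1 i) r ×ˢ C') := fun i => by
    refine (hφ i).comp (ContDiffOn.prodMk (by fun_prop)
      (hbase.comp contDiffOn_snd fun x hx => hx.2.1)) fun x hx => ⟨hshift i x hx, hx.2.2⟩
  have hΓd : ∀ i, ∀ x ∈ ball (P.1 i) r ×ˢ C',
      HasDerivAt (fun s => Γ i (s, x.2)) (genVec R i (Γ i x)) x.1 := fun i x hx =>
    ((h i _ hx.2.2).2 _ (hshift i x hx)).2.1.comp_sub_const x.1 (P.1 i)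
  -- The initial value of u is shared equally among the n summands: at the base point they add up to
  -- (g c).1, and on the i-th axis to the u-component of the i-th curve.
  set S : Fin n → ℝ × E → ℝ := fun i x => (Γ i x).2.1 - (g x.2).1 + (g x.2).1 / n
  have hS : ∀ i, ContDiffOn ℝ ∞ (S i) (ball (P.1 i) r ×ˢ C') := fun i => by
    have hg' : ContDiffOn ℝ ∞ (fun x : ℝ × E => (g x.2).1) (ball (P.1 i) r ×ˢ C') :=
      (hg.comp contDiffOn_snd fun x hx => hx.2.1).fst
    exact ((hΓ i).snd.fst.sub hg').add (hg'.div_const _)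
  -- Index 0 is S_i, indices 1, …, l are the u_i^{(k)}, and index l + 1 is R_i.
  let a : Fin n → ℕ → ℝ × E → ℝ := fun i k x =>
    if k = 0 then S i x else if hk : k - 1 < l then (Γ i x).2.2 i ⟨k - 1, hk⟩ else R i (Γ i x)
  have ha : ∀ i, ∀ k ≤ l + 1, EqOn (tderiv^[k] (S i)) (a i k) (ball (P.1 i) r ×ˢ C') := by
    intro i
    refine tderiv_iterate_eqOn (isOpen_ball.prod hC') (a := a i) (hS i) fun k hk x hx => ?_
    have hd := hasFDerivAt_snd.comp_hasDerivAt x.1 (hΓd i x hx)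
    rcases Nat.eq_zero_or_pos k with rfl | hpos
    · have h1 : HasDerivAt (fun s => (Γ i (s, x.2)).2.1) ((Γ i x).2.2 i 0) x.1 :=
        HasFDerivAt.comp_hasDerivAt (f := fun s => (Γ i (s, x.2)).2) x.1 hasFDerivAt_fst hd
      have hl : 0 < l := Nat.pos_of_ne_zero (NeZero.ne l)
      have h2 : a i 1 x = (Γ i x).2.2 i 0 := by
        simp only [a, one_ne_zero, if_false, Nat.sub_self, dif_pos hl]
        rfl
      rw [zero_add, h2]
      exact (h1.sub_const (g x.2).1).add_const ((g x.2).1 / n)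
    · have hk1 : k - 1 < l := by omega
      have h1 : HasDerivAt (fun s => (Γ i (s, x.2)).2.2 i ⟨k - 1, hk1⟩)
          ((genVec R i (Γ i x)).2.2 i ⟨k - 1, hk1⟩) x.1 :=
        hasDerivAt_pi.1 (hasDerivAt_pi.1 (hasFDerivAt_snd.comp_hasDerivAt x.1 hd) i) ⟨k - 1, hk1⟩
      have h2 : a i (k + 1) x = (genVec R i (Γ i x)).2.2 i ⟨k - 1, hk1⟩ := by
        have h3 : k - 1 + 1 = k := by omega
        simp only [a, Nat.succ_ne_zero, if_false, Nat.add_sub_cancel, genVec, Pi.single_eq_same, h3]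
      have h4 : (fun s => a i k (s, x.2)) = fun s => (Γ i (s, x.2)).2.2 i ⟨k - 1, hk1⟩ := by
        ext s
        simp only [a, hpos.ne', if_false, dif_pos hk1]
      rw [h2, h4]
      exact h1
  have hn : (n : ℝ) ≠ 0 := NeZero.ne _
  have hmem0 : ∀ i, ∀ c ∈ C', (P.1 i, c) ∈ ball (P.1 i) r ×ˢ C' := fun i c hc =>
    ⟨mem_ball_self hr, hc⟩
  have hΓ0 : ∀ i, ∀ c ∈ C', Γ i (P.1 i, c) = base c := fun i c hc => by
    simp only [Γ, sub_self]
    exact (h i _ hc.2).1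
  have hcomp : ∀ i (k : Fin l), ∀ x ∈ ball (P.1 i) r ×ˢ C',
      tderiv^[(k : ℕ) + 1] (S i) x = (Γ i x).2.2 i k := fun i k x hx => by
    rw [ha i _ (by have := k.2; omega) hx]
    simp only [a, Nat.succ_ne_zero, if_false, Nat.add_sub_cancel, dif_pos k.2]
  refine ⟨r, hr, C', inter_subset_left, hC', hc₀', S, hS, fun c hc => ?_, fun q hq c hc j => ?_⟩
  · refine Prod.ext ?_ (funext fun i => funext fun k => ?_)
    · simp only [fibreJet, S, hΓ0 _ c hc, base, sub_self, zero_add, Finset.sum_const,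
        Finset.card_univ, Fintype.card_fin, nsmul_eq_mul]
      field_simp
    · exact (hcomp i k _ (hmem0 i c hc)).trans (by rw [hΓ0 i c hc])
  · have hx : (q j, c) ∈ ball (P.1 j) r ×ˢ C' := ⟨hq j trivial, hc⟩
    obtain ⟨-, -, hpos, hother⟩ := (h j _ hc.2).2 _ (hshift j _ hx)
    have hl : ¬ l + 1 - 1 < l := by omega
    -- On the j-th axis the jet of the sum is the integral curve of D_j itself, since that curve
    -- leaves the u_i^{(k)} with i ≠ j constant.
    have hpt : Γ j (q j, c) = (Function.update P.1 j (q j),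
        fibreJet l S (Function.update P.1 j (q j), c)) := by
      refine Prod.ext (funext fun i => ?_) (Prod.ext ?_ (funext fun i => funext fun k => ?_))
      · refine (hpos i).trans ?_
        rcases eq_or_ne i j with rfl | hi
        · simp [base]
        · simp [base, hi]
      · have hterm : ∀ i, S i (Function.update P.1 j (q j) i, c) =
            (if i = j then (Γ j (q j, c)).2.1 - (g c).1 else 0) + (g c).1 / n := fun i => by
          rcases eq_or_ne i j with rfl | hi
          · simp [S]
          · rw [Function.update_of_ne hi, if_neg hi]
            simp only [S, hΓ0 i c hc, base, sub_self]
        simp only [fibreJet, hterm, Finset.sum_add_distrib, Finset.sum_ite_eq', Finset.mem_univ,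
          if_true, Finset.sum_const, Finset.card_univ, Fintype.card_fin, nsmul_eq_mul]
        field_simp
        ring
      · rcases eq_or_ne i j with rfl | hi
        · simp only [fibreJet, Function.update_self]
          exact (hcomp i k _ hx).symm
        · simp only [fibreJet, Function.update_of_ne hi]
          rw [hcomp i k _ (hmem0 i c hc), hΓ0 i c hc]
          exact congrFun (hother i hi) k
    rw [ha j _ le_rfl hx, ← hpt]
    simp only [a, Nat.succ_ne_zero, if_false, dif_neg hl]

end FlowFamily

/-! ### The constructed family solves the equation -/

section Sufficiency

variable {U : Set (FullJet n l)} {𝓗 : FullJet n l → ℝ} {P : M n l}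
  {R : Fin n → M n l → ℝ} {V : Set (M n l)}

/-- If dH(P) vanished on the fibre, D_i H(P) = 0 would make it vanish on every ∂/∂q^i too. So H can
serve as a coordinate on the fibre. -/
theorem fderiv_comp_inr_ne_zero {H : M n l → ℝ} (hgen : ∀ i, gen R i H P = 0)
    (hreg : fderiv ℝ H P ≠ 0) :
    (fderiv ℝ H P).comp (ContinuousLinearMap.inr ℝ (Fin n → ℝ) (ℝ × (Fin n → Fin l → ℝ))) ≠ 0 := by
  intro h0
  apply hreg
  have h1 : ∀ y, fderiv ℝ H P (0, y) = 0 := fun y => DFunLike.congr_fun h0 y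
  have h2 : ∀ i, fderiv ℝ H P (Pi.single i 1, 0) = 0 := fun i => by
    have h3 : genVec R i P = (Pi.single i 1, 0) + (0, (genVec R i P).2) := by simp [genVec]
    have h4 : fderiv ℝ H P (genVec R i P) = 0 := hgen i
    rwa [h3, map_add, h1, add_zero] at h4
  ext x
  · exact (clm_apply_eq_sum ((fderiv ℝ H P).comp (ContinuousLinearMap.inl ℝ _ _)) _).trans
      (Finset.sum_eq_zero fun i _ => by simp [h2])
  all_goals simp [h1]

/-- One constant plays two roles in the Goursat argument: a bound for H and R_j to start the
iteration, and K + |∂/∂u_i^{(l)}| as the Lipschitz factor. -/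
theorem exists_bound_topDeriv (hV : IsOpen V) (hPV : P ∈ V) {H : M n l → ℝ}
    (hH : ContDiffOn ℝ ∞ H V) (hR : ∀ i, ContDiffOn ℝ ∞ (R i) V) {K : ℝ} (hK : 0 ≤ K) :
    ∃ B, 0 ≤ B ∧ ∀ᶠ p in 𝓝 P, p ∈ V ∧ |H p| ≤ B ∧ (∀ j, |R j p| ≤ B) ∧
      (∀ i, K + |topDeriv i H p| ≤ B) ∧ ∀ i j, K + |topDeriv i (R j) p| ≤ B := by
  have hs1 : 0 ≤ ∑ j, (|R j P| + 1) := by positivity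
  have hs2 : 0 ≤ ∑ i, (|topDeriv i H P| + 1) := by positivity
  have hs3 : 0 ≤ ∑ i, ∑ j, (|topDeriv i (R j) P| + 1) := by positivity
  have hs4 := abs_nonneg (H P)
  refine ⟨K + (|H P| + 1) + ∑ j, (|R j P| + 1) + ∑ i, (|topDeriv i H P| + 1) +
    ∑ i, ∑ j, (|topDeriv i (R j) P| + 1), by positivity, ?_⟩
  refine (hV.eventually_mem hPV).and (Eventually.and ?_ (Eventually.and ?_
    (Eventually.and ?_ ?_)))
  · filter_upwards [eventually_abs_le hV hPV hH.continuousOn] with p hp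
    linarith
  · refine eventually_all.2 fun j => ?_
    filter_upwards [eventually_abs_le hV hPV (hR j).continuousOn] with p hp
    have := Finset.single_le_sum (f := fun j => |R j P| + 1) (fun _ _ => by positivity)
      (Finset.mem_univ j)
    linarith
  · refine eventually_all.2 fun i => ?_
    filter_upwards [eventually_abs_le hV hPV (contDiffOn_topDeriv hV hH i).continuousOn] with p hp
    have := Finset.single_le_sum (f := fun i => |topDeriv i H P| + 1) (fun _ _ => by positivity)
      (Finset.mem_univ i)
    linarith
  · refine eventually_all.2 fun i => eventually_all.2 fun j => ?_
    filter_upwards [eventually_abs_le hV hPV (contDiffOn_topDeriv hV (hR j) i).continuousOn]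
      with p hp
    have h1 := Finset.single_le_sum (f := fun i => ∑ j, (|topDeriv i (R j) P| + 1))
      (fun _ _ => by positivity) (Finset.mem_univ i)
    have h2 := Finset.single_le_sum (f := fun j => |topDeriv i (R j) P| + 1)
      (fun _ _ => by positivity) (Finset.mem_univ j)
    linarith

theorem exists_small_radius (n : ℕ) {B δ₀ : ℝ} (hB : 0 ≤ B) (hδ₀ : 0 < δ₀) :
    ∃ δ > 0, δ ≤ δ₀ ∧ n * (B * (2 * δ)) ≤ 1 / 2 := by
  -- The summand 1 keeps the denominator positive when B = 0.
  have hη : 0 < 1 / (4 * (n * B + 1)) := by positivity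
  refine ⟨min δ₀ (1 / (4 * (n * B + 1))), lt_min hδ₀ hη, min_le_left _ _, ?_⟩
  have h1 : (n * B + 1) * (1 / (4 * (n * B + 1))) = 1 / 4 := by field_simp
  have h2 : n * B * min δ₀ (1 / (4 * (n * B + 1))) ≤ n * B * (1 / (4 * (n * B + 1))) :=
    mul_le_mul_of_nonneg_left (min_le_right _ _) (by positivity)
  linarith

/-- The common core of conditions 1 and 3: the vector fields need to preserve H = 0 and to commute
only up to O(H). -/
theorem hasExtendedSolutionAt_of_abs_gen_le [NeZero n] (h𝓗 : ContDiffOn ℝ ∞ 𝓗 U)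
    (hV : IsOpen V) (hPV : P ∈ V) (hVU : V ⊆ incl ⁻¹' U) (hP : reduced 𝓗 P = 0)
    (hreg : fderiv ℝ (reduced 𝓗) P ≠ 0) (hR : ∀ i, ContDiffOn ℝ ∞ (R i) V)
    {K : ℝ} (hK : 0 ≤ K)
    (hKH : ∀ i, ∀ p ∈ V, |gen R i (reduced 𝓗) p| ≤ K * |reduced 𝓗 p|)
    (hKR : ∀ i j, j ≠ i → ∀ p ∈ V, |gen R i (R j) p| ≤ K * |reduced 𝓗 p|) :
    HasExtendedSolutionAt U 𝓗 P := by
  set H : M n l → ℝ := reduced 𝓗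
  have hH : ContDiffOn ℝ ∞ H V := (contDiffOn_reduced h𝓗).mono hVU
  have hd : ∀ {F : M n l → ℝ}, ContDiffOn ℝ ∞ F V → ∀ p ∈ V, DifferentiableAt ℝ F p :=
    fun hF p hp => (hF.contDiffAt (hV.mem_nhds hp)).differentiableAt (by simp)
  have hfd : HasFDerivAt (fun y => H (P.1, y))
      ((fderiv ℝ H P).comp (ContinuousLinearMap.inr ℝ (Fin n → ℝ) (ℝ × (Fin n → Fin l → ℝ)))) P.2 :=
    HasFDerivAt.comp (g := H) (f := fun y => ((P.1, y) : M n l)) P.2 (hd hH P hPV).hasFDerivAt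
      (hasFDerivAt_prodMk_right P.1 P.2)
  have hVfib : IsOpen ((fun y => ((P.1, y) : M n l)) ⁻¹' V) := hV.preimage (by fun_prop)
  obtain ⟨C, g, hC, h0C, hg, hg0, hgH, hginj⟩ := exists_parametrization (m := n * l)
    (by simp [Module.finrank_prod, Module.finrank_pi_fintype, add_comm]) hVfib
    (hH.comp (by fun_prop) fun y hy => hy) (y := P.2) hPV hP (by
      change fderiv ℝ (fun y => H (P.1, y)) P.2 ≠ 0
      rw [hfd.fderiv]
      exact fderiv_comp_inr_ne_zero (R := R)
        (fun i => abs_nonpos_iff.1 ((hKH i P hPV).trans (by simp [hP]))) hreg)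
  obtain ⟨r, hr, C', hC'C, hC', h0C', S, hS, hSg, haxis⟩ := exists_separated_family hV hR hPV hC hg
    h0C hg0
  have hI : ∀ i, IsOpen (ball (P.1 i) r) := fun i => isOpen_ball
  have hB := (isOpen_box hI).prod hC'
  have hfib := contDiffOn_fibreJet l hI hC' hS
  set Φ : (Fin n → ℝ) × (Fin (n * l + 1) → ℝ) → M n l := fun x => (x.1, fibreJet l S x)
  have hΦ : ContDiffOn ℝ ∞ Φ ((univ.pi fun i => ball (P.1 i) r) ×ˢ C') :=
    contDiffOn_fst.prodMk hfib
  have hx₀ : (P.1, (0 : Fin (n * l + 1) → ℝ)) ∈ (univ.pi fun i => ball (P.1 i) r) ×ˢ C' :=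
    ⟨fun i _ => mem_ball_self hr, h0C'⟩
  have hΦ0 : Φ (P.1, 0) = P := Prod.ext rfl ((hSg 0 h0C').trans hg0)
  obtain ⟨B, hB0, hev⟩ := exists_bound_topDeriv hV hPV hH hR hK
  have hΦc : ContinuousAt Φ (P.1, 0) := hΦ.continuousOn.continuousAt (hB.mem_nhds hx₀)
  rw [← hΦ0] at hev
  obtain ⟨δ₀, hδ₀, hball⟩ := Metric.eventually_nhds_iff_ball.1
    ((hB.eventually_mem hx₀).and (hΦc.eventually hev))
  obtain ⟨δ, hδ, hδmin, hsmall⟩ := exists_small_radius n hB0 (lt_min hδ₀ hr)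
  have hδδ₀ := hδmin.trans (min_le_left _ _)
  have hδr := hδmin.trans (min_le_right _ _)
  have hloc : ∀ q ∈ ball P.1 δ, ∀ c ∈ ball (0 : Fin (n * l + 1) → ℝ) δ, _ := fun q hq c hc =>
    hball (q, c) (by
      rw [← ball_prod_same]
      exact ⟨ball_subset_ball hδδ₀ hq, ball_subset_ball hδδ₀ hc⟩)
  have hpi : ball P.1 δ = univ.pi fun i => ball (P.1 i) δ := ball_pi _ hδ
  have hsol : ∀ q ∈ ball P.1 δ, ∀ c ∈ ball (0 : Fin (n * l + 1) → ℝ) δ,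
      c (Fin.last (n * l)) = 0 → H (Φ (q, c)) = 0 := by
    intro q hq c hc hlast
    have hmem : ∀ q ∈ ball P.1 δ, (q, c) ∈ (univ.pi fun i => ball (P.1 i) r) ×ˢ C' :=
      fun q hq => (hloc q hq c hc).1
    have hdΦ : ∀ q ∈ ball P.1 δ, HasFDerivAt (fun q => Φ (q, c))
        (((ContinuousLinearMap.fst ℝ _ _).prod (fderiv ℝ (fibreJet l S) (q, c))).comp
          (ContinuousLinearMap.inl ℝ _ _)) q := fun q hq =>
      HasFDerivAt.comp (g := Φ) (f := fun q => (q, c)) q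
        (hasFDerivAt_fst.prodMk ((hfib.contDiffAt (hB.mem_nhds (hmem q hq))).differentiableAt
          (by simp)).hasFDerivAt) (hasFDerivAt_prodMk_left q c)
    -- The derivative along the family is D_i plus a top-order correction, whose coefficient is the
    -- second error S_i^{(l+1)} − R_i∘Φ.
    have hchain : ∀ {F : M n l → ℝ}, ContDiffOn ℝ ∞ F V → ∀ q ∈ ball P.1 δ,
        DifferentiableAt ℝ (fun q => F (Φ (q, c))) q ∧
        ∀ i, pderiv i (fun q => F (Φ (q, c))) q = gen R i F (Φ (q, c)) +
          (tderiv^[l + 1] (S i) (q i, c) - R i (Φ (q, c))) * topDeriv i F (Φ (q, c)) := by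
      intro F hF q hq
      have h1 := (hd hF _ (hloc q hq c hc).2.1).hasFDerivAt.comp q (hdΦ q hq)
      refine ⟨h1.differentiableAt, fun i => ?_⟩
      rw [← gen_eq_add_topDeriv R (fun _ _ => tderiv^[l + 1] (S i) (q i, c)), gen,
        ← prod_fderiv_fibreJet_single hI hC' hS (hmem q hq) i, pderiv]
      exact congrArg (fun A => A (Pi.single i 1)) h1.fderiv
    have hest : ∀ {F : M n l → ℝ}, ContDiffOn ℝ ∞ F V → ∀ q ∈ ball P.1 δ, ∀ i b,
        |gen R i F (Φ (q, c))| ≤ K * |H (Φ (q, c))| → K + |topDeriv i F (Φ (q, c))| ≤ B →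
        |H (Φ (q, c))| ≤ b → |tderiv^[l + 1] (S i) (q i, c) - R i (Φ (q, c))| ≤ b →
        |pderiv i (fun q => F (Φ (q, c))) q| ≤ B * b := by
      intro F hF q hq i b h1 h2 h3 h4
      rw [(hchain hF q hq).2 i]
      refine (abs_add_le _ _).trans ?_
      rw [abs_mul]
      have hb : 0 ≤ b := (abs_nonneg _).trans h3
      refine (add_le_add (h1.trans (mul_le_mul_of_nonneg_left h3 hK))
        (mul_le_mul_of_nonneg_right h4 (abs_nonneg _))).trans ?_
      rw [mul_comm b, ← add_mul]
      exact mul_le_mul_of_nonneg_right h2 hb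
    refine eq_zero_of_goursat hδ hB0 hsmall (h := fun q => H (Φ (q, c)))
      (ψ := fun j q => R j (Φ (q, c))) (ρ := fun j t => tderiv^[l + 1] (S j) (t, c)) (b₀ := B)
      (fun q hq => (hchain hH q hq).1) (fun j q hq => (hchain (hR j) q hq).1) ?_
      (fun j q hq => haxis q (hmem q hq).1 c (hmem q hq).2 j)
      (fun q hq => (hloc q hq c hc).2.2.1) (fun j q hq => (hloc q hq c hc).2.2.2.1 j)
      (fun q hq b h1 h2 i => hest hH q hq i b (hKH i _ (hloc q hq c hc).2.1)
        ((hloc q hq c hc).2.2.2.2.1 i) h1 (h2 i))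
      (fun q hq b h1 h2 i j hj => hest (hR j) q hq i b (hKR i j hj _ (hloc q hq c hc).2.1)
        ((hloc q hq c hc).2.2.2.2.2 i j) h1 (h2 i)) q hq
    -- The remaining goal is that H vanishes over the base point: there H is the last parameter,
    -- which is 0.
    have hc' := (hmem P.1 (mem_ball_self hδ)).2
    simp only [Φ]
    rw [hSg c hc']
    exact (hgH c (hC'C hc')).trans hlast
  have hsub : ball (0 : Fin (n * l + 1) → ℝ) δ ⊆ C' := fun c hc =>
    (hloc P.1 (mem_ball_self hδ) c hc).1.2
  have hI' : ∀ i, IsOpen (ball (P.1 i) δ) := fun i => isOpen_ball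
  have hS' : ∀ i, ContDiffOn ℝ ∞ (S i) (ball (P.1 i) δ ×ˢ ball (0 : Fin (n * l + 1) → ℝ) δ) :=
    fun i => (hS i).mono (prod_mono (ball_subset_ball hδr) hsub)
  have hP1 : P.1 ∈ univ.pi fun i => ball (P.1 i) δ := fun i _ => mem_ball_self hδ
  refine hasExtendedSolutionAt_of_fibreJet hI' isOpen_ball hS' (fun q hq c hc hlast => ?_)
    hP1 (mem_ball_self hδ) rfl hΦ0 ?_
  · rw [← hpi] at hq
    exact ⟨hVU (hloc q hq c hc).2.1, hsol q hq c hc hlast⟩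
  -- Over the base point the family has the jets g(c), so its parameter derivative is that of the
  -- fibre coordinates.
  · have hgd : HasFDerivAt (fun c => fibreJet l S (P.1, c)) (fderiv ℝ g 0) 0 := by
      refine ((hg.contDiffAt (hC.mem_nhds h0C)).differentiableAt
        (by simp)).hasFDerivAt.congr_of_eventuallyEq ?_
      filter_upwards [hC'.mem_nhds h0C'] with c hc using hSg c hc
    rw [(hasFDerivAt_paramDeriv l hI' isOpen_ball hS' hP1 (mem_ball_self hδ)).unique hgd]
    exact hginj

/-- K is a local bound for the λ_i, and D_i R_j = 0 needs none. -/
theorem LocallyAt.hasExtendedSolutionAt_of_cond1On [NeZero n] (h𝓗 : ContDiffOn ℝ ∞ 𝓗 U)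
    (hP : reduced 𝓗 P = 0) (hreg : fderiv ℝ (reduced 𝓗) P ≠ 0)
    (h : LocallyAt U P (Cond1On (reduced 𝓗))) : HasExtendedSolutionAt U 𝓗 P := by
  obtain ⟨V, hV, hPV, hVU, R, lam, hR, hlam, hHlam, hcomm⟩ := h
  obtain ⟨W, hWb, hW, hPW⟩ := _root_.eventually_nhds_iff.1
    ((hV.eventually_mem hPV).and
      (eventually_all.2 fun i => eventually_abs_le hV hPV (hlam i).continuousOn))
  have hle : ∀ i, |lam i P| + 1 ≤ ∑ i, (|lam i P| + 1) := fun i =>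
    Finset.single_le_sum (f := fun i => |lam i P| + 1) (fun _ _ => by positivity)
      (Finset.mem_univ i)
  have hK : 0 ≤ ∑ i, (|lam i P| + 1) := by positivity
  refine hasExtendedSolutionAt_of_abs_gen_le h𝓗 hW hPW (fun p hp => hVU (hWb p hp).1) hP hreg
    (fun i => (hR i).mono fun p hp => (hWb p hp).1) hK
    (fun i p hp => ?_) (fun i j hj p hp => ?_)
  · rw [hHlam i p (hWb p hp).1, abs_mul]
    exact mul_le_mul_of_nonneg_right (((hWb p hp).2 i).trans (hle i)) (abs_nonneg _)
  · rw [hcomm i j hj p (hWb p hp).1, abs_zero]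
    positivity

/-- D_i R_j vanishes on H = 0, so it is a smooth multiple of H near P; K bounds the quotients. -/
theorem LocallyAt.hasExtendedSolutionAt_of_cond3On [NeZero n] (h𝓗 : ContDiffOn ℝ ∞ 𝓗 U)
    (hP : reduced 𝓗 P = 0) (hreg : fderiv ℝ (reduced 𝓗) P ≠ 0)
    (h : LocallyAt U P (Cond3On (reduced 𝓗))) : HasExtendedSolutionAt U 𝓗 P := by
  obtain ⟨V, hV, hPV, hVU, R, hR, hH0, hcomm⟩ := h
  have hH : ContDiffOn ℝ ∞ (reduced 𝓗) V := (contDiffOn_reduced h𝓗).mono hVU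
  have hquot : ∀ i j, ∃ K : ℝ, 0 ≤ K ∧ ∀ᶠ p in 𝓝 P, j ≠ i →
      |gen R i (R j) p| ≤ K * |reduced 𝓗 p| := by
    intro i j
    rcases eq_or_ne j i with rfl | hj
    · exact ⟨0, le_rfl, Eventually.of_forall fun p hp => absurd rfl hp⟩
    · obtain ⟨W, lam, hW, hPW, -, hlam, heq⟩ := exists_smooth_quotient hV hH
        (contDiffOn_gen hV hR (hR j) i) hPV hP hreg (hcomm i j hj)
      refine ⟨|lam P| + 1, by positivity, ?_⟩
      filter_upwards [hW.mem_nhds hPW, eventually_abs_le hW hPW hlam.continuousOn] with p hp hb _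
      rw [heq p hp, abs_mul]
      exact mul_le_mul_of_nonneg_right hb (abs_nonneg _)
  choose K hK0 hK using hquot
  obtain ⟨W, hWb, hW, hPW⟩ := _root_.eventually_nhds_iff.1
    ((hV.eventually_mem hPV).and
      (eventually_all.2 fun i => eventually_all.2 fun j => hK i j))
  have hle : ∀ i j, K i j ≤ ∑ i, ∑ j, K i j := fun i j =>
    (Finset.single_le_sum (fun j _ => hK0 i j) (Finset.mem_univ j)).trans
      (Finset.single_le_sum (f := fun i => ∑ j, K i j)
        (fun i _ => Finset.sum_nonneg fun j _ => hK0 i j) (Finset.mem_univ i))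
  have hKs : 0 ≤ ∑ i, ∑ j, K i j :=
    Finset.sum_nonneg fun i _ => Finset.sum_nonneg fun j _ => hK0 i j
  refine hasExtendedSolutionAt_of_abs_gen_le h𝓗 hW hPW (fun p hp => hVU (hWb p hp).1) hP hreg
    (fun i => (hR i).mono fun p hp => (hWb p hp).1) hKs (fun i p hp => ?_)
    (fun i j hj p hp => ?_)
  · rw [hH0 i p (hWb p hp).1, abs_zero]
    positivity
  · exact ((hWb p hp).2 i j hj).trans (mul_le_mul_of_nonneg_right (hle i j) (abs_nonneg _))

end Sufficiency

end Sufficient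

end NullSep

end

theorem theoremt {n l : ℕ} [NeZero n] [NeZero l]
    (U : Set (NullSep.FullJet n l)) (hU : IsOpen U)
    (𝓗 : NullSep.FullJet n l → ℝ) (h𝓗 : ContDiffOn ℝ ∞ 𝓗 U)
    (P : NullSep.M n l) (hPU : NullSep.incl P ∈ U)
    (hP : NullSep.reduced 𝓗 P = 0)
    (hreg : fderiv ℝ (NullSep.reduced 𝓗) P ≠ 0) :
    (NullSep.HasExtendedSolutionAt U 𝓗 P ↔ NullSep.HasInternalSolutionAt U 𝓗 P) ∧
    (NullSep.HasExtendedSolutionAt U 𝓗 P ↔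
      NullSep.LocallyAt U P (NullSep.Cond1On (NullSep.reduced 𝓗))) ∧
    (NullSep.HasExtendedSolutionAt U 𝓗 P ↔
      NullSep.LocallyAt U P (NullSep.Cond2On (NullSep.reduced 𝓗))) ∧
    (NullSep.LocallyAt U P (NullSep.Cond3On (NullSep.reduced 𝓗)) →
      NullSep.HasExtendedSolutionAt U 𝓗 P) ∧
    ((∀ i, NullSep.topDeriv i (NullSep.reduced 𝓗) P ≠ 0) →
      (NullSep.HasExtendedSolutionAt U 𝓗 P ↔
        NullSep.LocallyAt U P (NullSep.Cond3On (NullSep.reduced 𝓗)))) := by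
  have h21 : NullSep.LocallyAt U P (NullSep.Cond2On (NullSep.reduced 𝓗)) →
      NullSep.LocallyAt U P (NullSep.Cond1On (NullSep.reduced 𝓗)) := by
    rintro ⟨V, hV, hPV, hVU, hc⟩
    exact ⟨V, hV, hPV, hVU, hc.cond1On hV ((NullSep.contDiffOn_reduced h𝓗).mono hVU)⟩
  have hE2 : NullSep.HasExtendedSolutionAt U 𝓗 P →
      NullSep.LocallyAt U P (NullSep.Cond2On (NullSep.reduced 𝓗)) :=
    fun h => h.locallyAt_cond2On hU h𝓗 hreg
  have h1E : NullSep.LocallyAt U P (NullSep.Cond1On (NullSep.reduced 𝓗)) →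
      NullSep.HasExtendedSolutionAt U 𝓗 P :=
    fun h => h.hasExtendedSolutionAt_of_cond1On h𝓗 hP hreg
  have h3E : NullSep.LocallyAt U P (NullSep.Cond3On (NullSep.reduced 𝓗)) →
      NullSep.HasExtendedSolutionAt U 𝓗 P :=
    fun h => h.hasExtendedSolutionAt_of_cond3On h𝓗 hP hreg
  exact ⟨⟨fun h => h.hasInternalSolutionAt, fun h => h.hasExtendedSolutionAt⟩,
    ⟨fun h => h21 (hE2 h), h1E⟩, ⟨hE2, fun h => h1E (h21 h)⟩, h3E,
    fun htop => ⟨fun h => (h21 (hE2 h)).cond3On_of_cond1On h𝓗 htop, h3E⟩⟩
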